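/- Manifolds, maps, tensor fields, vector fields and functions are smooth. **Definitions.** Let $N$ be a manifold of dimension $\mathfrak n\ge 1$. *Metric hypersurface data* on $N$ consist of a symmetric $2$-covariant tensor $\gamma$, a covector field $\boldsymbol\ell$ and a function $\ell^{(2)}$ such that at every $p\in N$ the bilinear form $\mathcal A((W,a),(Z,b))=\gamma(W,Z)+a\,\boldsymbol\ell(Z)+b\,\boldsymbol\ell(W)+ab\,\ell^{(2)}$ on $T_pN\times\mathbb R$ is non-degenerate. They determine a symmetric contravariant tensor $P^{ab}$, a vector field $n^a$ and a function $n^{(2)}$ by $$\gamma_{ab}n^b+n^{(2)}\ell_a=0,\quad \ell_an^a+n^{(2)}\ell^{(2)}=1,\quad P^{ab}\ell_b+\ell^{(2)}n^a=0,\quad P^{ab}\gamma_{bc}+n^a\ell_c=\delta^a_c .$$ Put $\mathbf F=\tfrac12 d\boldsymbol\ell$, $\boldsymbol s=\mathbf F(n,\cdot)$, $\mathbf U=\tfrac12\pounds_n\gamma+\boldsymbol\ell\otimes_s dn^{(2)}$, and let $\overset{\circ}{\nabla}$ be the torsion-free connection with $\overset{\circ}{\nabla}_a\gamma_{bc}=-\ell_b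 U_{ac}-\ell_cU_{ab}$ and $\overset{\circ}{\nabla}_a\ell_b=F_{ab}-\ell^{(2)}U_{ab}$. *Hypersurface data* $\{N,\gamma,\boldsymbol\ell,\ell^{(2)},\mathbf Y\}$ are metric hypersurface data together with a symmetric $2$-covariant tensor $\mathbf Y$; they are *null* if $n^{(2)}=0$ everywhere. They are *embedded* in a Lorentzian manifold $(\mathcal M,g)$ (possibly with boundary) with embedding $\iota:N\to\mathcal M$ and rigging $\zeta$ (a vector field along $\iota$, nowhere tangent to $\iota(N)$) if $\gamma=\iota^\star g$, $\boldsymbol\ell=\iota^\star(g(\zeta,\cdot))$, $\ell^{(2)}=\iota^\star(g(\zeta,\zeta))$ and $\mathbf Y=\tfrac12\iota^\star(\pounds_\zeta g)$. The last expression only involves the values of $\zeta$ along $\iota$. For a function $z$ without zeros and a vector field $V$ put $$\mathcal G_{(z,V)}(\gamma,\boldsymbol\ell,\ell^{(2)})=\big(\gamma,\ z(\boldsymbol\ell+\gamma(V,\cdot)),\ z^2(\ell^{(2)}+2\boldsymbol\ell(V)+\gamma(V,V))\big).$$ **Setting.** Let $(\mathcal M^\pm,g^\pm)$ be $(\mathfrak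 n+1)$-dimensional Lorentzian manifolds with boundary, let $\iota^\pm:N\to\mathcal M^\pm$ be embeddings with $\iota^\pm(N)=\partial\mathcal M^\pm$, and let $L^\pm$ be riggings along $\iota^\pm$, each of which points outwards everywhere ($\epsilon^\pm=+1$) or inwards everywhere ($\epsilon^\pm=-1$). Let $\mathcal D=\{N,\gamma,\boldsymbol\ell,\ell^{(2)},\mathbf Y^-\}$ and $\widehat{\mathcal D}=\{N,\widehat\gamma,\widehat{\boldsymbol\ell},\widehat\ell^{(2)},\widehat{\mathbf Y}^+\}$ be null hypersurface data embedded in $(\mathcal M^-,g^-)$ with embedding $\iota^-$ and rigging $L^-$, respectively in $(\mathcal M^+,g^+)$ with embedding $\iota^+$ and rigging $L^+$. Hats denote objects built from $\widehat{\mathcal D}$; unhatted $P,n,\mathbf U,\boldsymbol s,\overset{\circ}{\nabla}$ are those of $\mathcal D$. Let $\epsilon=\epsilon^-$. Let $\varphi:N\to N$ be a diffeomorphism such that the matching conditions hold: for some function $z$ without zeros and some vector field $V$, (i) $\mathcal G_{(z,V)}(\varphi^\star\widehat\gamma,\varphi^\star\widehat{\boldsymbol\ell},\varphi^\star\widehat\ell^{(2)})=(\gamma,\boldsymbol\ell,\ell^{(2)})$;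 (ii) $\operatorname{sign}(z)=-\operatorname{sign}(\epsilon^+)\operatorname{sign}(\epsilon^-)$. From now on let $z$ and $V$ be given by the explicit formulas $$z=\frac1{(\varphi^\star\widehat{\boldsymbol\ell})(n)},\qquad V=-P(\varphi^\star\widehat{\boldsymbol\ell},\cdot)+\mu\,n,\qquad \mu=\frac{P(\varphi^\star\widehat{\boldsymbol\ell},\varphi^\star\widehat{\boldsymbol\ell})-\varphi^\star\widehat\ell^{(2)}}{2(\varphi^\star\widehat{\boldsymbol\ell})(n)},$$ let $\xi^+$ be the vector field along $\iota^+$ which at $\varphi(p)$, $p\in N$, equals $z(p)\big(L^++\iota^+_\star(\varphi_\star V)\big)$, and put $$\mathbf Y^+=\tfrac12\varphi^\star\big((\iota^+)^\star(\pounds_{\xi^+}g^+)\big),\qquad [\mathbf Y]=\mathbf Y^+-\mathbf Y^- .$$ Let $\{n,e_A\}$, $A=2,\dots,\mathfrak n$, be a basis of vector fields on an open set $O\subseteq N$ (for instance $O=N$ if there is a global basis) with dual basis $\{\boldsymbol\nu,\boldsymbol\theta^A\}$. Define covectors $\boldsymbol W_A$, vectors $W_A$ and functions $\chi_{(A)}$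 on $\varphi(O)$ by $$\varphi^\star\boldsymbol W_A=\gamma(e_A,\cdot),\qquad W_A=\widehat P(\boldsymbol W_A,\cdot),\qquad \chi_{(A)}=(\varphi^{-1})^\star\big(z^{-1}\boldsymbol\ell(e_A)\big)-\boldsymbol W_A(\varphi_\star V),$$ and let $\mathfrak h^{AB}$ be the inverse of the matrix $\gamma(e_A,e_B)$. The energy-momentum tensor of the shell is $$\tau^{df}=\epsilon\Big((P^{af}n^d+P^{ad}n^f)n^b-(n^{(2)}P^{af}P^{bd}+P^{df}n^an^b)+P^{ab}(n^{(2)}P^{df}-n^dn^f)\Big)[\mathbf Y]_{ab}.$$ **Claim.** On $O$, $$[\mathbf Y](n,n)=\frac1z\,\varphi^\star\big(\widehat{\mathbf Y}^+(\widehat n,\widehat n)\big)-\mathbf Y^-(n,n)+\frac{n(z)}z,$$ $$[\mathbf Y](n,e_A)=\varphi^\star\big(\widehat{\mathbf Y}^+(\widehat n,W_A)+\chi_{(A)}\widehat{\mathbf Y}^+(\widehat n,\widehat n)\big)-\mathbf Y^-(n,e_A)-\frac z2\big(\pounds_n\varphi^\star\widehat{\boldsymbol\ell}\big)(e_A)+\frac{e_A(z)}{2z}+\boldsymbol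 s(e_A)+zP\big(\varphi^\star\widehat{\boldsymbol\ell},\mathbf U(e_A,\cdot)\big),$$ $$[\mathbf Y](e_A,e_B)=z\,\varphi^\star\Big(\widehat{\mathbf Y}^+(W_A,W_B)+\chi_{(A)}\widehat{\mathbf Y}^+(\widehat n,W_B)+\chi_{(B)}\widehat{\mathbf Y}^+(\widehat n,W_A)+\chi_{(A)}\chi_{(B)}\widehat{\mathbf Y}^+(\widehat n,\widehat n)\Big)-\mathbf Y^-(e_A,e_B)-z\,e_A^ae_B^b\overset{\circ}{\nabla}_{(a}(\varphi^\star\widehat{\boldsymbol\ell})_{b)}+\frac{z^2}2\big(P(\varphi^\star\widehat{\boldsymbol\ell},\varphi^\star\widehat{\boldsymbol\ell})-\varphi^\star\widehat\ell^{(2)}\big)\mathbf U(e_A,e_B),$$ and the energy-momentum tensor is given by $$\tau(\boldsymbol\nu,\boldsymbol\nu)=-\epsilon\,\mathfrak h^{AB}[\mathbf Y](e_A,e_B),\qquad \tau(\boldsymbol\nu,\boldsymbol\theta^A)=\epsilon\,\mathfrak h^{AB}[\mathbf Y](n,e_B),\qquad \tau(\boldsymbol\theta^A,\boldsymbol\theta^B)=-\epsilon\,\mathfrak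 h^{AB}[\mathbf Y](n,n).$$ No topological assumption is made on $N$. -/

import Mathlib

open scoped Manifold ContDiff Bundle
open Bundle

namespace NullShell

noncomputable section

/-- The bilinear map `(u, v) ↦ T (A u) (B v)`. -/
def bicomp {V V' W W' : Type*}
    [AddCommGroup V] [Module ℝ V] [TopologicalSpace V]
    [AddCommGroup V'] [Module ℝ V'] [TopologicalSpace V']
    [AddCommGroup W] [Module ℝ W] [TopologicalSpace W]
    [AddCommGroup W'] [Module ℝ W'] [TopologicalSpace W']
    (T : V →L[ℝ] V' →L[ℝ] ℝ) (A : W →L[ℝ] V) (B : W' →L[ℝ] V') : W →L[ℝ] W' →L[ℝ] ℝ :=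
  (ContinuousLinearMap.precomp ℝ B).comp (T.comp A)

/-! ### Tensor calculus in charts -/

section Calculus

variable {E : Type*} [NormedAddCommGroup E] [NormedSpace ℝ E]
  {H : Type*} [TopologicalSpace H] (I : ModelWithCorners ℝ E H)
  (M : Type*) [TopologicalSpace M] [ChartedSpace H M]

/-- Vector fields. -/
abbrev VectorField := Π p : M, TangentSpace I p

/-- Covector fields. -/
abbrev OneForm := Π p : M, TangentSpace I p →L[ℝ] ℝ

/-- `2`-covariant tensor fields. -/
abbrev TwoTensor := Π p : M, TangentSpace I p →L[ℝ] TangentSpace I p →L[ℝ] ℝ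

variable {M} [IsManifold I ∞ M]

/-- Smoothness of a vector field. -/
def SmoothField (X : VectorField I M) : Prop :=
  ContMDiff I I.tangent ∞ (fun p => (⟨p, X p⟩ : TangentBundle I M))

/-- Smoothness of a covector field. -/
def SmoothForm (θ : OneForm I M) : Prop :=
  ContMDiff I (I.prod 𝓘(ℝ, E →L[ℝ] ℝ)) ∞
    (fun p => TotalSpace.mk' (E →L[ℝ] ℝ) p (θ p))

/-- Smoothness of a `2`-covariant tensor field. -/
def SmoothTensor (T : TwoTensor I M) : Prop :=
  ContMDiff I (I.prod 𝓘(ℝ, E →L[ℝ] E →L[ℝ] ℝ)) ∞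
    (fun p => TotalSpace.mk' (E →L[ℝ] E →L[ℝ] ℝ) p (T p))

/-- The components of a tangent vector at `x` in the coordinate basis of the chart around `x₀`
(the derivative of that chart at `x`). -/
def toCoord (x₀ x : M) : TangentSpace I x →L[ℝ] E :=
  (trivializationAt E (TangentSpace I) x₀).continuousLinearMapAt ℝ x

/-- The tangent vector at `x` with given components in the chart around `x₀`. -/
def ofCoord (x₀ x : M) : E →L[ℝ] TangentSpace I x :=
  (trivializationAt E (TangentSpace I) x₀).symmL ℝ x

/-- The components `θ_a(y)` of a covector field in the chart around `x₀`. -/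
def coordForm (x₀ : M) (θ : OneForm I M) (y : E) : E →L[ℝ] ℝ :=
  (θ ((extChartAt I x₀).symm y)).comp (ofCoord I x₀ ((extChartAt I x₀).symm y))

/-- The components `T_ab(y)` of a `2`-covariant tensor field in the chart around `x₀`. -/
def coordTensor (x₀ : M) (T : TwoTensor I M) (y : E) : E →L[ℝ] E →L[ℝ] ℝ :=
  bicomp (T ((extChartAt I x₀).symm y))
    (ofCoord I x₀ ((extChartAt I x₀).symm y)) (ofCoord I x₀ ((extChartAt I x₀).symm y))

/-- The components `X^a(y)` of a vector field in the chart around `x₀`. -/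
def coordField (x₀ : M) (X : VectorField I M) (y : E) : E :=
  toCoord I x₀ ((extChartAt I x₀).symm y) (X ((extChartAt I x₀).symm y))

/-- The partial derivatives `∂_a θ_b` at `p` of the components of a covector field in the chart
around `p`; the first slot is the direction of differentiation. -/
def partialForm (θ : OneForm I M) (p : M) : E →L[ℝ] E →L[ℝ] ℝ :=
  fderivWithin ℝ (coordForm I p θ) (Set.range I) (extChartAt I p p)

set_option synthInstance.maxHeartbeats 200000 in
/-- The partial derivatives `∂_a T_bc` at `p` of the components of a `2`-covariant tensor field
in the chart around `p`; the first slot is the direction of differentiation. -/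
def partialTensor (T : TwoTensor I M) (p : M) : E →L[ℝ] E →L[ℝ] E →L[ℝ] ℝ :=
  fderivWithin ℝ (coordTensor I p T) (Set.range I) (extChartAt I p p)

/-- The partial derivatives `∂_a X^b` at `p` of the components of a vector field in the chart
around `p`. -/
def partialField (X : VectorField I M) (p : M) : E →L[ℝ] E :=
  fderivWithin ℝ (coordField I p X) (Set.range I) (extChartAt I p p)

/-- The exterior derivative of a covector field: `(dθ)_ab = ∂_a θ_b - ∂_b θ_a`. -/
def extDerivForm (θ : OneForm I M) : TwoTensor I M := fun p =>
  bicomp (partialForm I θ p - (partialForm I θ p).flip) (toCoord I p p) (toCoord I p p)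

/-- The Lie derivative of a covector field: `(£_X θ)_b = X^a ∂_a θ_b + θ_a ∂_b X^a`. -/
def lieForm (X : VectorField I M) (θ : OneForm I M) : OneForm I M := fun p =>
  (partialForm I θ p (toCoord I p p (X p)) +
    (coordForm I p θ (extChartAt I p p)).comp (partialField I X p)).comp (toCoord I p p)

/-- The Lie derivative of a `2`-covariant tensor field:
`(£_X T)_ab = X^c ∂_c T_ab + T_cb ∂_a X^c + T_ac ∂_b X^c`. -/
def lieTensor (X : VectorField I M) (T : TwoTensor I M) : TwoTensor I M := fun p =>
  bicomp (partialTensor I T p (toCoord I p p (X p)) +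
      bicomp (coordTensor I p T (extChartAt I p p))
        (partialField I X p) (ContinuousLinearMap.id ℝ E) +
      bicomp (coordTensor I p T (extChartAt I p p))
        (ContinuousLinearMap.id ℝ E) (partialField I X p))
    (toCoord I p p) (toCoord I p p)

end Calculus

section Maps

variable {E : Type*} [NormedAddCommGroup E] [NormedSpace ℝ E]
  {H : Type*} [TopologicalSpace H] (I : ModelWithCorners ℝ E H)
  {N : Type*} [TopologicalSpace N] [ChartedSpace H N] [IsManifold I ∞ N]
  {E' : Type*} [NormedAddCommGroup E'] [NormedSpace ℝ E']
  {H' : Type*} [TopologicalSpace H'] (J : ModelWithCorners ℝ E' H')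
  {M : Type*} [TopologicalSpace M] [ChartedSpace H' M] [IsManifold J ∞ M]

/-- The pull-back `f^⋆ θ` of a covector field. -/
def pullForm (f : N → M) (θ : OneForm J M) : OneForm I N := fun p =>
  (θ (f p)).comp (mfderiv I J f p)

/-- The pull-back `f^⋆ T` of a `2`-covariant tensor field. -/
def pullTensor (f : N → M) (T : TwoTensor J M) : TwoTensor I N := fun p =>
  bicomp (T (f p)) (mfderiv I J f p) (mfderiv I J f p)

/-- Vector fields of `M` along a map `ι : N → M`. -/
abbrev FieldAlong (ι : N → M) := Π p : N, TangentSpace J (ι p)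

/-- Smoothness of a vector field along a smooth map. -/
def SmoothAlong (ι : N → M) (ζ : FieldAlong J ι) : Prop :=
  ContMDiff I J.tangent ∞ (fun p => (⟨ι p, ζ p⟩ : TangentBundle J M))

/-- The components `ζ^μ(y)` of a vector field along `ι`, as functions of the coordinates `y` of
the chart of `N` around `p`, in the chart of `M` around `ι p`. -/
def coordAlong (ι : N → M) (ζ : FieldAlong J ι) (p : N) (y : E) : E' :=
  toCoord J (ι p) (ι ((extChartAt I p).symm y)) (ζ ((extChartAt I p).symm y))

/-- The derivatives `∂_a ζ^μ` at `p` of the components of a vector field along `ι`. -/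
def partialAlong (ι : N → M) (ζ : FieldAlong J ι) (p : N) : E →L[ℝ] E' :=
  fderivWithin ℝ (coordAlong I J ι ζ p) (Set.range I) (extChartAt I p p)

/-- The pull-back `ι^⋆(£_ζ g)` for a vector field `ζ` that is only given along `ι`.
In coordinates `y^a` of `N` and `x^μ` of `M`, with `x^μ = ι^μ(y)`,
`(ι^⋆ £_ζ g)_ab = ζ^σ ∂_σ g_μν ∂_a ι^μ ∂_b ι^ν + g_μν ∂_a ζ^μ ∂_b ι^ν + g_μν ∂_a ι^μ ∂_b ζ^ν`,
so that only the values of `ζ` along `ι` are needed. -/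
def pullLie (ι : N → M) (ζ : FieldAlong J ι) (g : TwoTensor J M) : TwoTensor I N := fun p =>
  bicomp (partialTensor J g (ι p) (toCoord J (ι p) (ι p) (ζ p)))
      ((toCoord J (ι p) (ι p)).comp (mfderiv I J ι p))
      ((toCoord J (ι p) (ι p)).comp (mfderiv I J ι p)) +
  bicomp (coordTensor J (ι p) g (extChartAt J (ι p) (ι p)))
      ((partialAlong I J ι ζ p).comp (toCoord I p p))
      ((toCoord J (ι p) (ι p)).comp (mfderiv I J ι p)) +
  bicomp (coordTensor J (ι p) g (extChartAt J (ι p) (ι p)))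
      ((toCoord J (ι p) (ι p)).comp (mfderiv I J ι p))
      ((partialAlong I J ι ζ p).comp (toCoord I p p))

end Maps

/-! ### Hypersurface data -/

/-- The bilinear form `𝒜((W,a),(Z,b)) = γ(W,Z) + a ℓ(Z) + b ℓ(W) + a b ℓ⁽²⁾` on `T × ℝ`. -/
def ambientForm {T : Type*} [AddCommGroup T] [Module ℝ T] [TopologicalSpace T]
    [IsTopologicalAddGroup T] [ContinuousSMul ℝ T]
    (γ : T →L[ℝ] T →L[ℝ] ℝ) (ℓ : T →L[ℝ] ℝ) (c : ℝ) : LinearMap.BilinForm ℝ (T × ℝ) :=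
  LinearMap.mk₂ ℝ (fun w z => γ w.1 z.1 + w.2 * ℓ z.1 + z.2 * ℓ w.1 + w.2 * z.2 * c)
    (by intros; simp; ring) (by intros; simp; ring) (by intros; simp; ring)
    (by intros; simp; ring)

section Data

variable (m : ℕ) (N : Type*) [TopologicalSpace N]
  [ChartedSpace (EuclideanSpace ℝ (Fin (m + 1))) N] [IsManifold (𝓡 (m + 1)) ∞ N]

/-- Metric hypersurface data `{N, γ, ℓ, ℓ⁽²⁾}` on a manifold `N` of dimension `m + 1`. -/
structure MetricHypersurfaceData where
  γ : TwoTensor (𝓡 (m + 1)) N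
  ell : OneForm (𝓡 (m + 1)) N
  ell2 : N → ℝ
  γ_smooth : SmoothTensor (𝓡 (m + 1)) γ
  ell_smooth : SmoothForm (𝓡 (m + 1)) ell
  ell2_smooth : ContMDiff (𝓡 (m + 1)) 𝓘(ℝ, ℝ) ∞ ell2
  γ_symm : ∀ p u v, γ p u v = γ p v u
  nondegenerate : ∀ p, (ambientForm (γ p) (ell p) (ell2 p)).Nondegenerate

/-- Hypersurface data `{N, γ, ℓ, ℓ⁽²⁾, Y}`. -/
structure HypersurfaceData extends MetricHypersurfaceData m N where
  Y : TwoTensor (𝓡 (m + 1)) N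
  Y_smooth : SmoothTensor (𝓡 (m + 1)) Y
  Y_symm : ∀ p u v, Y p u v = Y p v u

variable {m N}

instance (p : N) : FiniteDimensional ℝ (TangentSpace (𝓡 (m + 1)) p) :=
  inferInstanceAs (FiniteDimensional ℝ (EuclideanSpace ℝ (Fin (m + 1))))

theorem lieTensor_apply (X : VectorField (𝓡 (m + 1)) N) (T : TwoTensor (𝓡 (m + 1)) N) (p : N)
    (u v : TangentSpace (𝓡 (m + 1)) p) :
    lieTensor (𝓡 (m + 1)) X T p u v =
      partialTensor (𝓡 (m + 1)) T p (toCoord _ p p (X p)) (toCoord _ p p u) (toCoord _ p p v) +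
      coordTensor (𝓡 (m + 1)) p T (extChartAt (𝓡 (m + 1)) p p)
        (partialField (𝓡 (m + 1)) X p (toCoord _ p p u)) (toCoord _ p p v) +
      coordTensor (𝓡 (m + 1)) p T (extChartAt (𝓡 (m + 1)) p p)
        (toCoord _ p p u) (partialField (𝓡 (m + 1)) X p (toCoord _ p p v)) := rfl

/-- The derivative of a family of symmetric bilinear forms is symmetric. -/
theorem fderivWithin_symm {E : Type*} [NormedAddCommGroup E] [NormedSpace ℝ E]
    {f : E → E →L[ℝ] E →L[ℝ] ℝ} (hf : ∀ y u v, f y u v = f y v u) {s : Set E} {x : E}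
    (hs : UniqueDiffWithinAt ℝ s x) (a b c : E) :
    fderivWithin ℝ f s x a b c = fderivWithin ℝ f s x a c b := by
  by_cases hd : DifferentiableWithinAt ℝ f s x
  · have key : ∀ b c, HasFDerivWithinAt (fun y => f y b c)
        (((fderivWithin ℝ f s x).flip b).flip c) s x := fun b c => by
      refine ((hd.hasFDerivWithinAt.clm_apply (hasFDerivWithinAt_const b x s)).clm_apply
        (hasFDerivWithinAt_const c x s)).congr_fderiv ?_
      ext a; simp
    have h := key c b
    rw [show (fun y => f y c b) = fun y => f y b c from funext fun y => hf y c b] at h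
    exact congrArg (fun L : E →L[ℝ] ℝ => L a) (hs.eq (key b c) h)
  · simp [fderivWithin_zero_of_not_differentiableWithinAt hd]

set_option synthInstance.maxHeartbeats 200000 in
theorem partialTensor_symm
    (T : TwoTensor (𝓡 (m + 1)) N) (hT : ∀ p u v, T p u v = T p v u) (p : N)
    (a b c : EuclideanSpace ℝ (Fin (m + 1))) :
    partialTensor (𝓡 (m + 1)) T p a b c = partialTensor (𝓡 (m + 1)) T p a c b :=
  fderivWithin_symm (fun _ _ _ => hT _ _ _)
    ((𝓡 (m + 1)).uniqueDiffOn _ (extChartAt_target_subset_range p (mem_extChartAt_target p))) a b c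

namespace MetricHypersurfaceData

variable (D : MetricHypersurfaceData m N)

/-- Raising an index with the inverse of `𝒜`. -/
def sharp (p : N) :
    Module.Dual ℝ (TangentSpace (𝓡 (m + 1)) p × ℝ) ≃ₗ[ℝ] (TangentSpace (𝓡 (m + 1)) p × ℝ) :=
  ((ambientForm (D.γ p) (D.ell p) (D.ell2 p)).toDual (D.nondegenerate p)).symm

/-- The vector field `n`, i.e. the `T_pN`-part of the vector dual to `(Z,b) ↦ b`. -/
def n : VectorField (𝓡 (m + 1)) N := fun p => (D.sharp p (LinearMap.snd ℝ _ ℝ)).1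

/-- The scalar `n⁽²⁾`, i.e. the `ℝ`-part of the vector dual to `(Z,b) ↦ b`. -/
def n2 (p : N) : ℝ := (D.sharp p (LinearMap.snd ℝ _ ℝ)).2

/-- The contravariant tensor `P`, as the map `θ ↦ P(θ, ·)` from covectors to vectors; this is the
`T_pN`-part of the vector dual to `(Z,b) ↦ θ(Z)`. -/
def P (p : N) : (TangentSpace (𝓡 (m + 1)) p →L[ℝ] ℝ) →ₗ[ℝ] TangentSpace (𝓡 (m + 1)) p where
  toFun θ := (D.sharp p (θ.toLinearMap.comp (LinearMap.fst ℝ _ ℝ))).1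
  map_add' α β := by simp [LinearMap.add_comp]
  map_smul' c α := by simp [LinearMap.smul_comp]

/-- The four relations that characterise `{P, n, n⁽²⁾}`. -/
theorem relations (p : N) :
    (∀ u, D.γ p (D.n p) u + D.n2 p * D.ell p u = 0) ∧
    (D.ell p (D.n p) + D.n2 p * D.ell2 p = 1) ∧
    (∀ θ, D.ell p (D.P p θ) + D.ell2 p * θ (D.n p) = 0) ∧
    (∀ u, D.P p (D.γ p u) + D.ell p u • D.n p = u) := by
  have key : ∀ (f : Module.Dual ℝ (TangentSpace (𝓡 (m + 1)) p × ℝ))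
      (x : TangentSpace (𝓡 (m + 1)) p × ℝ),
      D.γ p (D.sharp p f).1 x.1 + (D.sharp p f).2 * D.ell p x.1 + x.2 * D.ell p (D.sharp p f).1 +
        (D.sharp p f).2 * x.2 * D.ell2 p = f x := fun f x =>
    LinearMap.BilinForm.apply_toDual_symm_apply (hB := D.nondegenerate p) f x
  have hn : ∀ u, D.γ p (D.n p) u + D.n2 p * D.ell p u = 0 := fun u => by
    simpa [n, n2] using key (LinearMap.snd ℝ _ ℝ) (u, 0)
  have h1 : D.ell p (D.n p) + D.n2 p * D.ell2 p = 1 := by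
    simpa [n, n2] using key (LinearMap.snd ℝ _ ℝ) (0, 1)
  refine ⟨hn, h1, fun θ => ?_, fun u => ?_⟩
  · have a := key (θ.toLinearMap.comp (LinearMap.fst ℝ _ ℝ)) (0, 1)
    have b := key (θ.toLinearMap.comp (LinearMap.fst ℝ _ ℝ)) (D.n p, D.n2 p)
    have c := hn (D.sharp p (θ.toLinearMap.comp (LinearMap.fst ℝ _ ℝ))).1
    rw [D.γ_symm] at c
    simp only [LinearMap.comp_apply, LinearMap.fst_apply, map_zero,
      ContinuousLinearMap.coe_coe] at a b
    change D.ell p (D.sharp p (θ.toLinearMap.comp (LinearMap.fst ℝ _ ℝ))).1 + _ = 0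
    linear_combination a - D.ell2 p * (b - c -
      (D.sharp p (θ.toLinearMap.comp (LinearMap.fst ℝ _ ℝ))).2 * h1)
  · have h : D.sharp p ((D.γ p u).toLinearMap.comp (LinearMap.fst ℝ _ ℝ) +
        D.ell p u • LinearMap.snd ℝ _ ℝ) = (u, 0) := by
      rw [sharp, LinearEquiv.symm_apply_eq]
      ext x <;> simp [LinearMap.BilinForm.toDual_def, ambientForm]
    rw [map_add, map_smul] at h
    exact congrArg Prod.fst h

/-- `P` is symmetric. -/
theorem P_symm (p : N) (α β : TangentSpace (𝓡 (m + 1)) p →L[ℝ] ℝ) :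
    α (D.P p β) = β (D.P p α) := by
  have key : ∀ (f : Module.Dual ℝ (TangentSpace (𝓡 (m + 1)) p × ℝ))
      (x : TangentSpace (𝓡 (m + 1)) p × ℝ),
      D.γ p (D.sharp p f).1 x.1 + (D.sharp p f).2 * D.ell p x.1 + x.2 * D.ell p (D.sharp p f).1 +
        (D.sharp p f).2 * x.2 * D.ell2 p = f x := fun f x =>
    LinearMap.BilinForm.apply_toDual_symm_apply (hB := D.nondegenerate p) f x
  have a := key (α.toLinearMap.comp (LinearMap.fst ℝ _ ℝ))
    (D.sharp p (β.toLinearMap.comp (LinearMap.fst ℝ _ ℝ)))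
  have b := key (β.toLinearMap.comp (LinearMap.fst ℝ _ ℝ))
    (D.sharp p (α.toLinearMap.comp (LinearMap.fst ℝ _ ℝ)))
  rw [D.γ_symm] at a
  simp only [LinearMap.comp_apply, LinearMap.fst_apply, ContinuousLinearMap.coe_coe] at a b
  change α (D.sharp p (β.toLinearMap.comp (LinearMap.fst ℝ _ ℝ))).1 =
    β (D.sharp p (α.toLinearMap.comp (LinearMap.fst ℝ _ ℝ))).1
  linear_combination b - a

/-- The data is null if `n⁽²⁾` vanishes everywhere. -/
def IsNull : Prop := ∀ p, D.n2 p = 0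

/-- The tensor `F = ½ dℓ`. -/
def F : TwoTensor (𝓡 (m + 1)) N := fun p => (1 / 2 : ℝ) • extDerivForm (𝓡 (m + 1)) D.ell p

/-- The covector `s = F(n, ·)`. -/
def s : OneForm (𝓡 (m + 1)) N := fun p => D.F p (D.n p)

/-- The tensor `U = ½ £_n γ + ℓ ⊗ₛ dn⁽²⁾`. -/
def U : TwoTensor (𝓡 (m + 1)) N := fun p =>
  (1 / 2 : ℝ) • lieTensor (𝓡 (m + 1)) D.n D.γ p +
    (1 / 2 : ℝ) • ((D.ell p).smulRight (mvfderiv (𝓡 (m + 1)) D.n2 p) +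
      (mvfderiv (𝓡 (m + 1)) D.n2 p).smulRight (D.ell p))

/-- The covector `w ↦ ½ (∂_a γ_bd + ∂_b γ_ad - ∂_d γ_ab) u^a v^b w^d` at `p`
(in the chart around `p`). -/
def firstKind (p : N) (u v : TangentSpace (𝓡 (m + 1)) p) : TangentSpace (𝓡 (m + 1)) p →L[ℝ] ℝ :=
  ((1 / 2 : ℝ) •
    (partialTensor (𝓡 (m + 1)) D.γ p (toCoord (𝓡 (m + 1)) p p u) (toCoord (𝓡 (m + 1)) p p v) +
     partialTensor (𝓡 (m + 1)) D.γ p (toCoord (𝓡 (m + 1)) p p v) (toCoord (𝓡 (m + 1)) p p u) -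
     ((partialTensor (𝓡 (m + 1)) D.γ p).flip (toCoord (𝓡 (m + 1)) p p u)).flip
        (toCoord (𝓡 (m + 1)) p p v))).comp (toCoord (𝓡 (m + 1)) p p)

/-- The connection coefficients `Γ^c_ab u^a v^b` at `p`, in the chart around `p`, of the metric
hypersurface connection `∇°`:
`Γ^c_ab = ½ P^cd (∂_a γ_bd + ∂_b γ_ad - ∂_d γ_ab) + ½ n^c (∂_a ℓ_b + ∂_b ℓ_a)`. -/
def christoffel (p : N) (u v : TangentSpace (𝓡 (m + 1)) p) : TangentSpace (𝓡 (m + 1)) p :=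
  D.P p (D.firstKind p u v) +
    ((1 / 2 : ℝ) *
      (partialForm (𝓡 (m + 1)) D.ell p (toCoord (𝓡 (m + 1)) p p u) (toCoord (𝓡 (m + 1)) p p v) +
       partialForm (𝓡 (m + 1)) D.ell p (toCoord (𝓡 (m + 1)) p p v) (toCoord (𝓡 (m + 1)) p p u)))
      • D.n p

theorem U_apply (p : N) (u v : TangentSpace (𝓡 (m + 1)) p) :
    D.U p u v = (1 / 2 : ℝ) * lieTensor (𝓡 (m + 1)) D.n D.γ p u v +
      (1 / 2 : ℝ) * (D.ell p u * mvfderiv (𝓡 (m + 1)) D.n2 p v +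
        mvfderiv (𝓡 (m + 1)) D.n2 p u * D.ell p v) := rfl

theorem U_symm (p : N) (u v : TangentSpace (𝓡 (m + 1)) p) : D.U p u v = D.U p v u := by
  have h2 : ∀ a b, coordTensor (𝓡 (m + 1)) p D.γ (extChartAt (𝓡 (m + 1)) p p) a b =
      coordTensor (𝓡 (m + 1)) p D.γ (extChartAt (𝓡 (m + 1)) p p) b a :=
    fun a b => D.γ_symm _ _ _
  rw [U_apply, U_apply, lieTensor_apply, lieTensor_apply,
    partialTensor_symm D.γ D.γ_symm p _ (toCoord _ p p u) (toCoord _ p p v),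
    h2 (toCoord _ p p u), h2 (toCoord _ p p v)]
  ring

/-- The defining equations of the metric hypersurface connection determine its coefficients: if
`Γ` is symmetric (no torsion) and, in the chart around `p`,
`∂_a γ_bc - Γ^d_ab γ_dc - Γ^d_ac γ_bd = - ℓ_b U_ac - ℓ_c U_ab` and
`∂_a ℓ_b - Γ^d_ab ℓ_d = F_ab - ℓ⁽²⁾ U_ab`, then `Γ = christoffel`. -/
theorem eq_christoffel (p : N)
    (Γ : TangentSpace (𝓡 (m + 1)) p → TangentSpace (𝓡 (m + 1)) p → TangentSpace (𝓡 (m + 1)) p)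
    (hΓ : ∀ u v, Γ u v = Γ v u)
    (hγ : ∀ u v w, partialTensor (𝓡 (m + 1)) D.γ p (toCoord _ p p u) (toCoord _ p p v)
        (toCoord _ p p w) - D.γ p (Γ u v) w - D.γ p v (Γ u w) =
      -(D.ell p v * D.U p u w) - D.ell p w * D.U p u v)
    (hell : ∀ u v, partialForm (𝓡 (m + 1)) D.ell p (toCoord _ p p u) (toCoord _ p p v) -
        D.ell p (Γ u v) = D.F p u v - D.ell2 p * D.U p u v)
    (u v : TangentSpace (𝓡 (m + 1)) p) : Γ u v = D.christoffel p u v := by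
  obtain ⟨-, -, h3, h4⟩ := D.relations p
  have hF : ∀ u v, D.F p u v = -(D.F p v u) := fun u v => by
    change (1 / 2 : ℝ) * (partialForm (𝓡 (m + 1)) D.ell p (toCoord _ p p u) (toCoord _ p p v) -
        partialForm (𝓡 (m + 1)) D.ell p (toCoord _ p p v) (toCoord _ p p u)) = -((1 / 2 : ℝ) *
        (partialForm (𝓡 (m + 1)) D.ell p (toCoord _ p p v) (toCoord _ p p u) -
        partialForm (𝓡 (m + 1)) D.ell p (toCoord _ p p u) (toCoord _ p p v)))
    ring
  have hk : D.firstKind p u v = D.γ p (Γ u v) - D.U p u v • D.ell p := by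
    ext w
    change (1 / 2 : ℝ) *
      (partialTensor (𝓡 (m + 1)) D.γ p (toCoord _ p p u) (toCoord _ p p v) (toCoord _ p p w) +
       partialTensor (𝓡 (m + 1)) D.γ p (toCoord _ p p v) (toCoord _ p p u) (toCoord _ p p w) -
       partialTensor (𝓡 (m + 1)) D.γ p (toCoord _ p p w) (toCoord _ p p u) (toCoord _ p p v)) =
      D.γ p (Γ u v) w - D.U p u v * D.ell p w
    have e1 := hγ u v w
    have e2 := hγ v u w
    have e3 := hγ w u v
    rw [hΓ v u, D.U_symm p v u] at e2
    rw [hΓ w u, hΓ w v, D.U_symm p w v, D.U_symm p w u, D.γ_symm p (Γ u w) v] at e3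
    linear_combination (1 / 2 : ℝ) * (e1 + e2 - e3)
  have he : (1 / 2 : ℝ) *
      (partialForm (𝓡 (m + 1)) D.ell p (toCoord _ p p u) (toCoord _ p p v) +
       partialForm (𝓡 (m + 1)) D.ell p (toCoord _ p p v) (toCoord _ p p u)) =
      D.ell p (Γ u v) - D.ell2 p * D.U p u v := by
    have e1 := hell u v
    have e2 := hell v u
    rw [hΓ v u, D.U_symm p v u, hF v u] at e2
    linear_combination (1 / 2 : ℝ) * (e1 + e2)
  have h5 : D.P p (D.ell p) = -(D.ell2 p • D.n p) := by
    have : T2Space (TangentSpace (𝓡 (m + 1)) p) :=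
      inferInstanceAs (T2Space (EuclideanSpace ℝ (Fin (m + 1))))
    rw [← sub_eq_zero, ← Module.forall_dual_apply_eq_zero_iff ℝ]
    intro f
    have e1 := D.P_symm p (LinearMap.toContinuousLinearMap f) (D.ell p)
    have e2 := h3 (LinearMap.toContinuousLinearMap f)
    simp only [LinearMap.coe_toContinuousLinearMap'] at e1 e2
    simp only [map_sub, map_neg, map_smul, smul_eq_mul]
    linear_combination e1 + e2
  rw [christoffel, hk, he, map_sub, map_smul, h5]
  nth_rewrite 1 [← h4 (Γ u v)]
  module

/-- The covariant derivative `u^a v^b ∇°_a θ_b = u^a v^b (∂_a θ_b - Γ^c_ab θ_c)`. -/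
def nablaForm (θ : OneForm (𝓡 (m + 1)) N) (p : N) (u v : TangentSpace (𝓡 (m + 1)) p) : ℝ :=
  partialForm (𝓡 (m + 1)) θ p (toCoord (𝓡 (m + 1)) p p u) (toCoord (𝓡 (m + 1)) p p v) -
    θ p (D.christoffel p u v)

/-- The symmetrized covariant derivative `u^a v^b ∇°_(a θ_b)`. -/
def symNablaForm (θ : OneForm (𝓡 (m + 1)) N) (p : N) (u v : TangentSpace (𝓡 (m + 1)) p) : ℝ :=
  (1 / 2 : ℝ) * (D.nablaForm θ p u v + D.nablaForm θ p v u)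

/-- The energy-momentum tensor `τ^{df}` of a shell with sign `ε` and jump `[Y]` of `Y`:
`τ^{df} = ε ((P^{af} n^d + P^{ad} n^f) n^b - (n⁽²⁾ P^{af} P^{bd} + P^{df} n^a n^b)
  + P^{ab} (n⁽²⁾ P^{df} - n^d n^f)) [Y]_{ab}`,
evaluated on the covectors `α_d` and `β_f`. -/
def energyMomentum (ε : ℝ) (jY : TwoTensor (𝓡 (m + 1)) N) (p : N)
    (α β : TangentSpace (𝓡 (m + 1)) p →L[ℝ] ℝ) : ℝ :=
  ε * ((α (D.n p) * jY p (D.P p β) (D.n p) + β (D.n p) * jY p (D.P p α) (D.n p))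
    - (D.n2 p * jY p (D.P p β) (D.P p α) + α (D.P p β) * jY p (D.n p) (D.n p))
    + LinearMap.trace ℝ (TangentSpace (𝓡 (m + 1)) p)
        ((D.P p).comp (jY p).toLinearMap) *
      (D.n2 p * α (D.P p β) - α (D.n p) * β (D.n p)))

end MetricHypersurfaceData

end Data

/-! ### Spacetimes with boundary, embedded data -/

section Matching

variable {m : ℕ}

/-- A smooth Lorentzian metric, of signature `(-,+,…,+)`, on a manifold with boundary `M` of
dimension `m + 2`. -/
structure LorentzMetric (m : ℕ) (M : Type*) [TopologicalSpace M]
    [ChartedSpace (EuclideanHalfSpace (m + 2)) M] [IsManifold (𝓡∂ (m + 2)) ∞ M] where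
  g : TwoTensor (𝓡∂ (m + 2)) M
  smooth : SmoothTensor (𝓡∂ (m + 2)) g
  symm : ∀ x u v, g x u v = g x v u
  lorentzian : ∀ x, ∃ b : Module.Basis (Fin (m + 2)) ℝ (TangentSpace (𝓡∂ (m + 2)) x),
    ∀ i j, g x (b i) (b j) = if i = j then (if i = 0 then -1 else 1) else 0

variable {N : Type*} [TopologicalSpace N]
  [ChartedSpace (EuclideanSpace ℝ (Fin (m + 1))) N] [IsManifold (𝓡 (m + 1)) ∞ N]
  {M : Type*} [TopologicalSpace M]
  [ChartedSpace (EuclideanHalfSpace (m + 2)) M] [IsManifold (𝓡∂ (m + 2)) ∞ M]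

/-- `ζ` is a rigging of `ι(N)`: a smooth vector field along `ι`, everywhere transversal. -/
structure IsRigging (ι : N → M) (ζ : FieldAlong (𝓡∂ (m + 2)) ι) : Prop where
  smooth : SmoothAlong (𝓡 (m + 1)) (𝓡∂ (m + 2)) ι ζ
  transversal : ∀ p, ζ p ∉ Set.range (mfderiv (𝓡 (m + 1)) (𝓡∂ (m + 2)) ι p)

/-- The hypersurface data is embedded in `(M, g)` with embedding `ι` and rigging `ζ`. -/
structure HypersurfaceData.IsEmbedded (D : HypersurfaceData m N) (G : LorentzMetric m M)
    (ι : N → M) (ζ : FieldAlong (𝓡∂ (m + 2)) ι) : Prop where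
  embedding : Manifold.IsSmoothEmbedding (𝓡 (m + 1)) (𝓡∂ (m + 2)) ∞ ι
  rigging : IsRigging ι ζ
  γ_eq : D.γ = pullTensor (𝓡 (m + 1)) (𝓡∂ (m + 2)) ι G.g
  ell_eq : ∀ p, D.ell p = (G.g (ι p) (ζ p)).comp (mfderiv (𝓡 (m + 1)) (𝓡∂ (m + 2)) ι p)
  ell2_eq : ∀ p, D.ell2 p = G.g (ι p) (ζ p) (ζ p)
  Y_eq : ∀ p, D.Y p = (1 / 2 : ℝ) • pullLie (𝓡 (m + 1)) (𝓡∂ (m + 2)) ι ζ G.g p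

/-- `ε = 1` and `ζ` points outwards from `M`, or `ε = -1` and `ζ` points inwards. The coordinate
of index `0` of a chart is nonnegative on `M` and vanishes on the boundary. -/
def RiggingSign (ι : N → M) (ζ : FieldAlong (𝓡∂ (m + 2)) ι) (ε : ℝ) : Prop :=
  (ε = 1 ∧ ∀ p, (toCoord (𝓡∂ (m + 2)) (ι p) (ι p) (ζ p)) 0 < 0) ∨
  (ε = -1 ∧ ∀ p, 0 < (toCoord (𝓡∂ (m + 2)) (ι p) (ι p) (ζ p)) 0)

/-! ### Gauge transformations and matching conditions -/

/-- `𝒢_(z,V)(ℓ) = z (ℓ + γ(V, ·))`. -/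
def gaugeEll (z : N → ℝ) (V : VectorField (𝓡 (m + 1)) N) (γ : TwoTensor (𝓡 (m + 1)) N)
    (ell : OneForm (𝓡 (m + 1)) N) : OneForm (𝓡 (m + 1)) N :=
  fun p => z p • (ell p + γ p (V p))

/-- `𝒢_(z,V)(ℓ⁽²⁾) = z² (ℓ⁽²⁾ + 2 ℓ(V) + γ(V, V))`. -/
def gaugeEll2 (z : N → ℝ) (V : VectorField (𝓡 (m + 1)) N) (γ : TwoTensor (𝓡 (m + 1)) N)
    (ell : OneForm (𝓡 (m + 1)) N) (ell2 : N → ℝ) : N → ℝ :=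
  fun p => z p ^ 2 * (ell2 p + 2 * ell p (V p) + γ p (V p) (V p))

/-- The matching conditions for the gauge element `𝒢_(z,V)` and the diffeomorphism `φ`:
`𝒢_(z,V)` maps `{φ^⋆γ̂, φ^⋆ℓ̂, φ^⋆ℓ̂⁽²⁾}` to `{γ, ℓ, ℓ⁽²⁾}` (it does not change the first tensor),
and `sign z = - sign ε⁺ sign ε⁻`. -/
structure MatchingConditions (D Dh : HypersurfaceData m N)
    (φ : N ≃ₘ^∞⟮𝓡 (m + 1), 𝓡 (m + 1)⟯ N) (z : N → ℝ) (V : VectorField (𝓡 (m + 1)) N)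
    (εp εm : ℝ) : Prop where
  z_smooth : ContMDiff (𝓡 (m + 1)) 𝓘(ℝ, ℝ) ∞ z
  z_ne_zero : ∀ p, z p ≠ 0
  V_smooth : SmoothField (𝓡 (m + 1)) V
  γ_eq : pullTensor (𝓡 (m + 1)) (𝓡 (m + 1)) φ Dh.γ = D.γ
  ell_eq : gaugeEll z V (pullTensor (𝓡 (m + 1)) (𝓡 (m + 1)) φ Dh.γ)
    (pullForm (𝓡 (m + 1)) (𝓡 (m + 1)) φ Dh.ell) = D.ell
  ell2_eq : gaugeEll2 z V (pullTensor (𝓡 (m + 1)) (𝓡 (m + 1)) φ Dh.γ)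
    (pullForm (𝓡 (m + 1)) (𝓡 (m + 1)) φ Dh.ell) (Dh.ell2 ∘ φ) = D.ell2
  sign_eq : ∀ p, SignType.sign (z p) = -(SignType.sign εp * SignType.sign εm)

/-- The push-forward `φ_⋆ X` of a vector field by a diffeomorphism. -/
def push (φ : N ≃ₘ^∞⟮𝓡 (m + 1), 𝓡 (m + 1)⟯ N) (X : VectorField (𝓡 (m + 1)) N) :
    VectorField (𝓡 (m + 1)) N :=
  VectorField.mpullback (𝓡 (m + 1)) (𝓡 (m + 1)) φ.symm X

section Explicit

variable (D Dh : HypersurfaceData m N) (φ : N ≃ₘ^∞⟮𝓡 (m + 1), 𝓡 (m + 1)⟯ N)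

/-- The covector field `φ^⋆ ℓ̂`. -/
def pullEll : OneForm (𝓡 (m + 1)) N := pullForm (𝓡 (m + 1)) (𝓡 (m + 1)) φ Dh.ell

/-- `z = 1 / (φ^⋆ ℓ̂)(n)`. -/
def matchZ (p : N) : ℝ := 1 / pullEll Dh φ p (D.n p)

/-- `P(φ^⋆ ℓ̂, φ^⋆ ℓ̂) - φ^⋆ ℓ̂⁽²⁾`. -/
def matchQ (p : N) : ℝ := pullEll Dh φ p (D.P p (pullEll Dh φ p)) - Dh.ell2 (φ p)

/-- `μ = (P(φ^⋆ ℓ̂, φ^⋆ ℓ̂) - φ^⋆ ℓ̂⁽²⁾) / (2 (φ^⋆ ℓ̂)(n))`. -/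
def matchMu (p : N) : ℝ := matchQ D Dh φ p / (2 * pullEll Dh φ p (D.n p))

/-- `V = - P(φ^⋆ ℓ̂, ·) + μ n`. -/
def matchV : VectorField (𝓡 (m + 1)) N := fun p =>
  -(D.P p (pullEll Dh φ p)) + matchMu D Dh φ p • D.n p

/-- The matching rigging `ξ⁺ = z' (L⁺ - ι⁺_⋆ φ_⋆ (P(φ^⋆ ℓ̂, ·)) + μ ι⁺_⋆ φ_⋆ n)` along `ι⁺`, where
`z'` and `μ` at `ι⁺(φ p)` are the values of `matchZ` and `matchMu` at `p`. -/
def matchRigging (ι : N → M) (L : FieldAlong (𝓡∂ (m + 2)) ι) : FieldAlong (𝓡∂ (m + 2)) ι :=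
  fun q => matchZ D Dh φ (φ.symm q) •
    (L q - mfderiv (𝓡 (m + 1)) (𝓡∂ (m + 2)) ι q
        (push φ (fun p => D.P p (pullEll Dh φ p)) q) +
      matchMu D Dh φ (φ.symm q) • mfderiv (𝓡 (m + 1)) (𝓡∂ (m + 2)) ι q (push φ D.n q))

/-- `Y⁺ = ½ φ^⋆((ι⁺)^⋆(£_{ξ⁺} g⁺))`. -/
def Yplus (G : LorentzMetric m M) (ι : N → M) (L : FieldAlong (𝓡∂ (m + 2)) ι) :
    TwoTensor (𝓡 (m + 1)) N := fun p =>
  (1 / 2 : ℝ) • pullTensor (𝓡 (m + 1)) (𝓡 (m + 1)) φ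
    (pullLie (𝓡 (m + 1)) (𝓡∂ (m + 2)) ι (matchRigging D Dh φ ι L) G.g) p

/-- The jump `[Y] = Y⁺ - Y⁻`. -/
def jumpY (G : LorentzMetric m M) (ι : N → M) (L : FieldAlong (𝓡∂ (m + 2)) ι) :
    TwoTensor (𝓡 (m + 1)) N := fun p => Yplus D Dh φ G ι L p - D.Y p

/-- The covector field `𝑾` with `φ^⋆ 𝑾 = γ(e, ·)`. -/
def covW (e : VectorField (𝓡 (m + 1)) N) : OneForm (𝓡 (m + 1)) N := fun q =>
  (D.γ (φ.symm q) (e (φ.symm q))).comp (mfderiv (𝓡 (m + 1)) (𝓡 (m + 1)) φ.symm q)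

/-- The vector field `W = P̂(𝑾, ·)`. -/
def vecW (e : VectorField (𝓡 (m + 1)) N) : VectorField (𝓡 (m + 1)) N := fun q =>
  Dh.P q (covW D φ e q)

/-- The function `χ = (φ⁻¹)^⋆(z⁻¹ ψ) - 𝑾(φ_⋆ V)`, with `ψ = ℓ(e)`. -/
def chi (e : VectorField (𝓡 (m + 1)) N) (q : N) : ℝ :=
  (matchZ D Dh φ (φ.symm q))⁻¹ * D.ell (φ.symm q) (e (φ.symm q)) -
    covW D φ e q (push φ (matchV D Dh φ) q)

end Explicit

/-- The inverse `𝔥^{AB}` of the matrix `𝔥_{AB} = γ(e_A, e_B)`. -/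
def invFrameMetric (D : HypersurfaceData m N) (e : Fin m → VectorField (𝓡 (m + 1)) N) (p : N) :
    Matrix (Fin m) (Fin m) ℝ :=
  (Matrix.of fun A B => D.γ p (e A p) (e B p))⁻¹

end Matching

end

end NullShell

/-! Write η = φ^⋆ℓ̂. Everything follows from one tensorial identity,
`MatchingConditions.jumpY_apply`: [Y] = z φ^⋆Ŷ⁺ - Y⁻ - z ∇°_(a η_b) + (z²/2)(P(η,η) - φ^⋆ℓ̂⁽²⁾) U.
The claim is its evaluation on the frame {n, e_A}.

The identity has two sources. The matching rigging is z (L⁺ + ι_⋆ φ_⋆ V). The Leibniz rule for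
£_{zξ} g and the naturality ι^⋆(£_{ι_⋆ X} g) = £_X(ι^⋆ g) then give Y⁺ as z φ^⋆Ŷ⁺ plus (z/2) £_V γ
plus the symmetrized product of dz and η + γ(V, ·) (`lieTensor_pullTensor`, `pullLie_gauge`,
`Yplus_apply`). On the other hand, differentiating the gauge relation ℓ = z (η + γ(V, ·)) and
inserting the equations of the connection ∇° expresses z £_V γ through dz, ∇°η and U
(`IsNull.lieTensor_γ`). When the two are added, the dz terms cancel.

The explicit z and V enter by uniqueness: γ(V, ·) and ℓ(V) determine V, and the matching conditions
fix both, so any admissible pair is the explicit one (`eq_matchZ`, `eq_matchV`). Smoothness of z and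
V thus comes from the matching conditions.

On the frame, φ_⋆ n = z⁻¹ n̂ and φ_⋆ e_A = W_A + χ_(A) n̂, the latter being the decomposition P̂γ̂ +
n̂ ⊗ ℓ̂ = δ. Contractions of ∇°η with n are computed from ∇°_u n = s(u) n + P(U(u, ·), ·) and the
derivative of η(n) = 1/z, while U(n, ·) = 0 because the data is null.

The energy-momentum tensor is linear algebra at a point (`energyMomentum_frame`): since γ(n, ·) = 0,
the matrix P(θ^A, θ^B) is the inverse of γ(e_A, e_B), and all components of P along ν cancel. -/

namespace NullShell

open scoped Topology

noncomputable section

/-! ### Components of tensor fields in a chart, and their differentiability. -/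

section Charts

variable {E : Type*} [NormedAddCommGroup E] [NormedSpace ℝ E]
  {H : Type*} [TopologicalSpace H] {I : ModelWithCorners ℝ E H}
  {M : Type*} [TopologicalSpace M] [ChartedSpace H M] [IsManifold I ∞ M]

theorem toCoord_ofCoord {x₀ x : M} (hx : x ∈ (chartAt H x₀).source) (w : E) :
    toCoord I x₀ x (ofCoord I x₀ x w) = w :=
  Trivialization.continuousLinearMapAt_symmL _ (by simpa using hx) w

theorem ofCoord_toCoord {x₀ x : M} (hx : x ∈ (chartAt H x₀).source) (v : TangentSpace I x) :
    ofCoord I x₀ x (toCoord I x₀ x v) = v :=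
  Trivialization.symmL_continuousLinearMapAt _ (by simpa using hx) v

theorem bicomp_apply {V V' W W' : Type*}
    [AddCommGroup V] [Module ℝ V] [TopologicalSpace V]
    [AddCommGroup V'] [Module ℝ V'] [TopologicalSpace V']
    [AddCommGroup W] [Module ℝ W] [TopologicalSpace W]
    [AddCommGroup W'] [Module ℝ W'] [TopologicalSpace W']
    (T : V →L[ℝ] V' →L[ℝ] ℝ) (A : W →L[ℝ] V) (B : W' →L[ℝ] V') (u : W) (v : W') :
    bicomp T A B u v = T (A u) (B v) := rfl

theorem coordForm_apply (x₀ : M) (θ : OneForm I M) (y w : E) :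
    coordForm I x₀ θ y w =
      θ ((extChartAt I x₀).symm y) (ofCoord I x₀ ((extChartAt I x₀).symm y) w) := rfl

theorem coordTensor_apply (x₀ : M) (T : TwoTensor I M) (y u v : E) :
    coordTensor I x₀ T y u v =
      T ((extChartAt I x₀).symm y) (ofCoord I x₀ ((extChartAt I x₀).symm y) u)
        (ofCoord I x₀ ((extChartAt I x₀).symm y) v) := rfl

theorem coordForm_toCoord {x₀ : M} (θ : OneForm I M) {y : E} (hy : y ∈ (extChartAt I x₀).target)
    (v : TangentSpace I ((extChartAt I x₀).symm y)) :
    coordForm I x₀ θ y (toCoord I x₀ _ v) = θ _ v := by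
  rw [coordForm_apply, ofCoord_toCoord]
  simpa using (extChartAt I x₀).map_target hy

theorem coordForm_self (p : M) (θ : OneForm I M) (v : TangentSpace I p) :
    coordForm I p θ (extChartAt I p p) (toCoord I p p v) = θ p v := by
  rw [coordForm_apply]
  conv_rhs => rw [← ofCoord_toCoord (mem_chart_source H p) v]
  rw [extChartAt_to_inv]

theorem coordTensor_self (p : M) (T : TwoTensor I M) (u v : TangentSpace I p) :
    coordTensor I p T (extChartAt I p p) (toCoord I p p u) (toCoord I p p v) = T p u v := by
  rw [coordTensor_apply]
  conv_rhs => rw [← ofCoord_toCoord (mem_chart_source H p) u,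
    ← ofCoord_toCoord (mem_chart_source H p) v]
  rw [extChartAt_to_inv]

theorem coordField_self (p : M) (X : VectorField I M) :
    coordField I p X (extChartAt I p p) = toCoord I p p (X p) := by
  rw [coordField, extChartAt_to_inv]

theorem coordForm_coordField {x₀ : M} (θ : OneForm I M) (X : VectorField I M) {y : E}
    (hy : y ∈ (extChartAt I x₀).target) :
    coordForm I x₀ θ y (coordField I x₀ X y) =
      θ ((extChartAt I x₀).symm y) (X ((extChartAt I x₀).symm y)) :=
  coordForm_toCoord θ hy _

omit [IsManifold I ∞ M] in
theorem differentiableWithinAt_comp_symm {F : Type*} [NormedAddCommGroup F] [NormedSpace ℝ F]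
    {p : M} {f : M → F} (hf : ContMDiffAt I 𝓘(ℝ, F) ∞ f p) :
    DifferentiableWithinAt ℝ (fun y => f ((extChartAt I p).symm y)) (Set.range I)
      (extChartAt I p p) := by
  have := (contMDiffAt_iff.1 hf).2
  simp only [extChartAt_model_space_eq_id] at this
  exact this.differentiableWithinAt (by simp)

theorem SmoothForm.differentiableWithinAt {θ : OneForm I M} (hθ : SmoothForm I θ) (p : M) :
    DifferentiableWithinAt ℝ (coordForm I p θ) (Set.range I) (extChartAt I p p) := by
  have h := ((contMDiffAt_hom_bundle _).1 (hθ p)).2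
  refine differentiableWithinAt_comp_symm (p := p)
    (f := fun x => (θ x).comp (ofCoord I p x)) (h.congr_of_eventuallyEq ?_)
  filter_upwards [(chartAt H p).open_source.mem_nhds (mem_chart_source H p)] with x hx
  ext w
  simp [ContinuousLinearMap.inCoordinates, ofCoord]

set_option synthInstance.maxHeartbeats 200000 in
-- Smoothness of a section of a hom bundle means smoothness of its expression in the trivialization.
-- The bundle of 2-tensors is a hom bundle into a hom bundle, so the trivialization is unfolded
-- twice; on the chart domain it is composition with `ofCoord` in both slots.
theorem SmoothTensor.differentiableWithinAt {T : TwoTensor I M} (hT : SmoothTensor I T) (p : M) :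
    DifferentiableWithinAt ℝ (coordTensor I p T) (Set.range I) (extChartAt I p p) := by
  have h := ((contMDiffAt_hom_bundle _).1 (hT p)).2
  refine differentiableWithinAt_comp_symm (p := p)
    (f := fun x => bicomp (T x) (ofCoord I p x) (ofCoord I p x)) (h.congr_of_eventuallyEq ?_)
  filter_upwards [(chartAt H p).open_source.mem_nhds (mem_chart_source H p)] with x hx
  ext u v
  simp only [ContinuousLinearMap.inCoordinates, ContinuousLinearMap.comp_apply,
    Trivialization.continuousLinearMapAt_apply]
  rw [Trivialization.linearMapAt_apply, if_pos (by simpa using hx), hom_trivializationAt_apply]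
  simp [ContinuousLinearMap.inCoordinates, ofCoord, bicomp]

theorem differentiableWithinAt_coordField {X : VectorField I M} {p : M}
    (hX : ContMDiffAt I I.tangent ∞ (fun p => (⟨p, X p⟩ : TangentBundle I M)) p) :
    DifferentiableWithinAt ℝ (coordField I p X) (Set.range I) (extChartAt I p p) := by
  have h := (contMDiffAt_totalSpace.1 hX).2
  refine differentiableWithinAt_comp_symm (p := p)
    (f := fun x => toCoord I p x (X x)) (h.congr_of_eventuallyEq ?_)
  filter_upwards [(chartAt H p).open_source.mem_nhds (mem_chart_source H p)] with x hx
  rw [toCoord, Trivialization.continuousLinearMapAt_apply, Trivialization.linearMapAt_apply,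
    if_pos (by simpa using hx)]

/-- At the centre of its own chart, `toCoord` is the identity of the model space, so the manifold
derivative is literally the derivative of the coordinate expression. -/
theorem mvfderiv_eq {F : Type*} [NormedAddCommGroup F] [NormedSpace ℝ F]
    {p : M} {f : M → F} (hf : ContMDiffAt I 𝓘(ℝ, F) ∞ f p) (v : TangentSpace I p) :
    mvfderiv I f p v = fderivWithin ℝ (fun y => f ((extChartAt I p).symm y)) (Set.range I)
      (extChartAt I p p) (toCoord I p p v) := by
  rw [toCoord, TangentBundle.continuousLinearMapAt_trivializationAt (mem_chart_source H p),
    mfderiv_extChartAt_self]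
  exact congrArg (fun L : E →L[ℝ] F => L v) (hf.mdifferentiableAt (by simp)).mfderiv

end Charts

/-! ### Pull-backs and fields along a map, in coordinates. -/

section MapsInCharts

variable {E : Type*} [NormedAddCommGroup E] [NormedSpace ℝ E]
  {H : Type*} [TopologicalSpace H] {I : ModelWithCorners ℝ E H} [I.Boundaryless]
  {N : Type*} [TopologicalSpace N] [ChartedSpace H N] [IsManifold I ∞ N]
  {E' : Type*} [NormedAddCommGroup E'] [NormedSpace ℝ E']
  {H' : Type*} [TopologicalSpace H'] {J : ModelWithCorners ℝ E' H'}
  {M : Type*} [TopologicalSpace M] [ChartedSpace H' M] [IsManifold J ∞ M]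

omit [IsManifold I ∞ N] [IsManifold J ∞ M] in
theorem contDiffAt_writtenInExtChartAt {ι : N → M} (hι : ContMDiff I J ∞ ι) (p : N) :
    ContDiffAt ℝ ∞ (writtenInExtChartAt I J p ι) (extChartAt I p p) := by
  have := (contMDiffAt_iff.1 (hι p)).2
  rwa [I.range_eq_univ, contDiffWithinAt_univ] at this

/-- `toCoord` and `ofCoord` are the differentials of the chart and of its inverse, so this is the
chain rule for chart ∘ ι ∘ inverse chart. It holds on a neighbourhood of p, not only at p, which is
what allows the component formulas below to be differentiated. -/
theorem toCoord_mfderiv_ofCoord {ι : N → M} (hι : ContMDiff I J ∞ ι) {p x : N}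
    (hx : x ∈ (chartAt H p).source) (hιx : ι x ∈ (chartAt H' (ι p)).source) (w : E) :
    toCoord J (ι p) (ι x) (mfderiv I J ι x (ofCoord I p x w)) =
      fderiv ℝ (writtenInExtChartAt I J p ι) (extChartAt I p x) w := by
  have h1 : MDifferentiableAt 𝓘(ℝ, E) I (extChartAt I p).symm (extChartAt I p x) := by
    have := mdifferentiableWithinAt_extChartAt_symm (I := I) (x := p)
      ((extChartAt I p).map_source (by simpa using hx))
    rwa [I.range_eq_univ, mdifferentiableWithinAt_univ] at this
  have hxx : (extChartAt I p).symm (extChartAt I p x) = x :=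
    (extChartAt I p).left_inv (by simpa using hx)
  have h2 : MDifferentiableAt I J ι ((extChartAt I p).symm (extChartAt I p x)) :=
    (hι _).mdifferentiableAt (by simp)
  have h3 : MDifferentiableAt J 𝓘(ℝ, E') (extChartAt J (ι p))
      (ι ((extChartAt I p).symm (extChartAt I p x))) := by
    rw [hxx]; exact mdifferentiableAt_extChartAt hιx
  rw [toCoord, ofCoord, TangentBundle.continuousLinearMapAt_trivializationAt hιx,
    TangentBundle.symmL_trivializationAt hx, ← mfderiv_eq_fderiv, I.range_eq_univ,
    mfderivWithin_univ, writtenInExtChartAt, mfderiv_comp (f := ι ∘ (extChartAt I p).symm) _ h3 (h2.comp _ h1),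
    mfderiv_comp _ h2 h1]
  -- The chain rule lands in the tangent space at the chart inverse of the chart of x, which is x
  -- only propositionally; `key` transports along that equality.
  have key : ∀ x', x' = x → ∀ u : E,
      (mfderiv J 𝓘(ℝ, E') (extChartAt J (ι p)) (ι x') (mfderiv I J ι x' u) : E') =
        mfderiv J 𝓘(ℝ, E') (extChartAt J (ι p)) (ι x) (mfderiv I J ι x u) := by
    rintro _ rfl u; rfl
  exact (key _ hxx _).symm

theorem toCoord_mfderiv {ι : N → M} (hι : ContMDiff I J ∞ ι) {p x : N}
    (hx : x ∈ (chartAt H p).source) (hιx : ι x ∈ (chartAt H' (ι p)).source)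
    (v : TangentSpace I x) :
    toCoord J (ι p) (ι x) (mfderiv I J ι x v) =
      fderiv ℝ (writtenInExtChartAt I J p ι) (extChartAt I p x) (toCoord I p x v) := by
  rw [← toCoord_mfderiv_ofCoord hι hx hιx, ofCoord_toCoord hx]

omit [IsManifold I ∞ N] in
/-- Near the centre, a chart and its inverse can be used on both sides of a continuous map. -/
theorem eventually_mem_charts {ι : N → M} (hι : Continuous ι) (p : N) :
    ∀ᶠ y in 𝓝 (extChartAt I p p), y ∈ (extChartAt I p).target ∧
      (extChartAt I p).symm y ∈ (chartAt H p).source ∧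
      ι ((extChartAt I p).symm y) ∈ (chartAt H' (ι p)).source := by
  have h1 := extChartAt_target_mem_nhds (I := I) p
  have h2 : Filter.Tendsto (fun y => ι ((extChartAt I p).symm y)) (𝓝 (extChartAt I p p))
      (𝓝 (ι p)) := by
    have := (hι.continuousAt (x := (extChartAt I p).symm (extChartAt I p p))).comp
      (continuousAt_extChartAt_symm (I := I) p)
    simpa [ContinuousAt, Function.comp_def] using this
  filter_upwards [h1, h2 ((chartAt H' (ι p)).open_source.mem_nhds (mem_chart_source H' (ι p)))]
    with y hy hy'
  exact ⟨hy, by simpa using (extChartAt I p).map_target hy, hy'⟩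

theorem coordTensor_pullTensor {ι : N → M} (hι : ContMDiff I J ∞ ι) (T : TwoTensor J M) (p : N) :
    ∀ᶠ y in 𝓝 (extChartAt I p p), coordTensor I p (pullTensor I J ι T) y =
      bicomp (coordTensor J (ι p) T (writtenInExtChartAt I J p ι y))
        (fderiv ℝ (writtenInExtChartAt I J p ι) y) (fderiv ℝ (writtenInExtChartAt I J p ι) y) := by
  filter_upwards [eventually_mem_charts (I := I) (H' := H') hι.continuous p] with y ⟨h1, h2, h3⟩
  ext u v
  have hy : extChartAt I p ((extChartAt I p).symm y) = y := (extChartAt I p).right_inv h1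
  have key := fun w => toCoord_mfderiv_ofCoord (J := J) hι h2 h3 w
  rw [hy] at key
  rw [bicomp_apply, ← key, ← key]
  have hιy : (extChartAt J (ι p)).symm (writtenInExtChartAt I J p ι y) =
      ι ((extChartAt I p).symm y) := (extChartAt J (ι p)).left_inv (by simpa using h3)
  rw [coordTensor_apply, coordTensor_apply, hιy, ofCoord_toCoord h3, ofCoord_toCoord h3]
  rfl

theorem coordForm_pullForm {ι : N → M} (hι : ContMDiff I J ∞ ι) (θ : OneForm J M) (p : N) :
    ∀ᶠ y in 𝓝 (extChartAt I p p), coordForm I p (pullForm I J ι θ) y =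
      (coordForm J (ι p) θ (writtenInExtChartAt I J p ι y)).comp
        (fderiv ℝ (writtenInExtChartAt I J p ι) y) := by
  filter_upwards [eventually_mem_charts (I := I) (H' := H') hι.continuous p] with y ⟨h1, h2, h3⟩
  ext u
  have hy : extChartAt I p ((extChartAt I p).symm y) = y := (extChartAt I p).right_inv h1
  have key := fun w => toCoord_mfderiv_ofCoord (J := J) hι h2 h3 w
  rw [hy] at key
  rw [ContinuousLinearMap.comp_apply, ← key]
  have hιy : (extChartAt J (ι p)).symm (writtenInExtChartAt I J p ι y) =
      ι ((extChartAt I p).symm y) := (extChartAt J (ι p)).left_inv (by simpa using h3)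
  rw [coordForm_apply, coordForm_apply, hιy, ofCoord_toCoord h3]
  rfl

theorem coordAlong_mfderiv {ι : N → M} (hι : ContMDiff I J ∞ ι) (X : VectorField I N) (p : N) :
    ∀ᶠ y in 𝓝 (extChartAt I p p), coordAlong I J ι (fun q => mfderiv I J ι q (X q)) p y =
      fderiv ℝ (writtenInExtChartAt I J p ι) y (coordField I p X y) := by
  filter_upwards [eventually_mem_charts (I := I) (H' := H') hι.continuous p] with y ⟨h1, h2, h3⟩
  have hy : extChartAt I p ((extChartAt I p).symm y) = y := (extChartAt I p).right_inv h1
  rw [coordAlong, toCoord_mfderiv hι h2 h3, hy]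
  rfl

omit [IsManifold I ∞ N] in
theorem SmoothAlong.differentiableAt {ι : N → M} {ζ : FieldAlong J ι}
    (hζ : SmoothAlong I J ι ζ) (p : N) :
    DifferentiableAt ℝ (coordAlong I J ι ζ p) (extChartAt I p p) := by
  have h := (contMDiffAt_totalSpace.1 (hζ p)).2
  have hι : ContMDiffAt I J ∞ ι p := (contMDiffAt_totalSpace.1 (hζ p)).1
  have := differentiableWithinAt_comp_symm (p := p)
    (f := fun x => toCoord J (ι p) (ι x) (ζ x)) (h.congr_of_eventuallyEq ?_)
  · rwa [I.range_eq_univ, differentiableWithinAt_univ] at this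
  filter_upwards [hι.continuousAt.preimage_mem_nhds
    ((chartAt H' (ι p)).open_source.mem_nhds (mem_chart_source H' (ι p)))] with x hx
  rw [toCoord, Trivialization.continuousLinearMapAt_apply, Trivialization.linearMapAt_apply,
    if_pos (by simpa using hx)]

end MapsInCharts

/-! ### Product rules for bilinear and linear expressions. -/

section ProductRule

variable {E E' : Type*} [NormedAddCommGroup E] [NormedSpace ℝ E]
  [NormedAddCommGroup E'] [NormedSpace ℝ E']

set_option synthInstance.maxHeartbeats 200000 in
theorem fderiv_bilin_apply {f : E → E' →L[ℝ] E' →L[ℝ] ℝ} {f' : E →L[ℝ] E' →L[ℝ] E' →L[ℝ] ℝ}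
    {a b : E → E'} {a' b' : E →L[ℝ] E'} {x : E} (hf : HasFDerivAt f f' x)
    (ha : HasFDerivAt a a' x) (hb : HasFDerivAt b b' x) (w : E) :
    fderiv ℝ (fun y => f y (a y) (b y)) x w =
      f' w (a x) (b x) + f x (a' w) (b x) + f x (a x) (b' w) := by
  rw [((hf.clm_apply ha).clm_apply hb).fderiv]
  simp
  ring

theorem fderiv_lin_apply {F : Type*} [NormedAddCommGroup F] [NormedSpace ℝ F]
    {f : E → E' →L[ℝ] F} {f' : E →L[ℝ] E' →L[ℝ] F}
    {a : E → E'} {a' : E →L[ℝ] E'} {x : E} (hf : HasFDerivAt f f' x)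
    (ha : HasFDerivAt a a' x) (w : E) :
    fderiv ℝ (fun y => f y (a y)) x w = f' w (a x) + f x (a' w) := by
  rw [(hf.clm_apply ha).fderiv]
  simp [add_comm]

end ProductRule

/-! ### Lie derivatives along a map: naturality and the Leibniz rule. -/

section LieDerivative

variable {E : Type*} [NormedAddCommGroup E] [NormedSpace ℝ E]
  {H : Type*} [TopologicalSpace H] {I : ModelWithCorners ℝ E H} [I.Boundaryless]
  {N : Type*} [TopologicalSpace N] [ChartedSpace H N] [IsManifold I ∞ N]
  {E' : Type*} [NormedAddCommGroup E'] [NormedSpace ℝ E']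
  {H' : Type*} [TopologicalSpace H'] {J : ModelWithCorners ℝ E' H'}
  {M : Type*} [TopologicalSpace M] [ChartedSpace H' M] [IsManifold J ∞ M]

theorem lieTensor_eq (X : VectorField J M) (T : TwoTensor J M) (p : M) (u v : TangentSpace J p) :
    lieTensor J X T p u v =
      partialTensor J T p (toCoord J p p (X p)) (toCoord J p p u) (toCoord J p p v) +
      coordTensor J p T (extChartAt J p p) (partialField J X p (toCoord J p p u))
        (toCoord J p p v) +
      coordTensor J p T (extChartAt J p p) (toCoord J p p u)
        (partialField J X p (toCoord J p p v)) := rfl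

omit [I.Boundaryless] in
theorem pullLie_eq (ι : N → M) (ζ : FieldAlong J ι) (g : TwoTensor J M) (p : N)
    (u v : TangentSpace I p) :
    pullLie I J ι ζ g p u v =
      partialTensor J g (ι p) (toCoord J (ι p) (ι p) (ζ p))
        (toCoord J (ι p) (ι p) (mfderiv I J ι p u)) (toCoord J (ι p) (ι p) (mfderiv I J ι p v)) +
      coordTensor J (ι p) g (extChartAt J (ι p) (ι p))
        (partialAlong I J ι ζ p (toCoord I p p u)) (toCoord J (ι p) (ι p) (mfderiv I J ι p v)) +
      coordTensor J (ι p) g (extChartAt J (ι p) (ι p))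
        (toCoord J (ι p) (ι p) (mfderiv I J ι p u)) (partialAlong I J ι ζ p (toCoord I p p v)) :=
  rfl

omit [I.Boundaryless] [IsManifold I ∞ N] [IsManifold J ∞ M] in
theorem writtenInExtChartAt_self (ι : N → M) (p : N) :
    writtenInExtChartAt I J p ι (extChartAt I p p) = extChartAt J (ι p) (ι p) := by
  simp [writtenInExtChartAt]

omit [IsManifold I ∞ N] [IsManifold J ∞ M] in
/-- The chain rule through the chart representation of a smooth map. -/
theorem hasFDerivAt_comp_writtenInExtChartAt {F : Type*} [NormedAddCommGroup F] [NormedSpace ℝ F]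
    {ι : N → M} (hι : ContMDiff I J ∞ ι) (p : N) {G : E' → F}
    (hG : DifferentiableWithinAt ℝ G (Set.range J) (extChartAt J (ι p) (ι p))) :
    HasFDerivAt (fun y => G (writtenInExtChartAt I J p ι y))
      ((fderivWithin ℝ G (Set.range J) (extChartAt J (ι p) (ι p))).comp
        (fderiv ℝ (writtenInExtChartAt I J p ι) (extChartAt I p p))) (extChartAt I p p) := by
  have h1 := ((contDiffAt_writtenInExtChartAt hι p).differentiableAt (by simp)).hasFDerivAt
  have h2 := hG.hasFDerivWithinAt
  rw [← writtenInExtChartAt_self (I := I) (J := J) ι p] at h2 ⊢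
  rw [← hasFDerivWithinAt_univ] at h1 ⊢
  exact h2.comp _ h1 fun y _ => ⟨_, rfl⟩

set_option synthInstance.maxHeartbeats 200000 in
/-- `£_X (ι^⋆ T) = ι^⋆ (£_{ι_⋆ X} T)`. -/
theorem lieTensor_pullTensor {ι : N → M} (hι : ContMDiff I J ∞ ι) {T : TwoTensor J M}
    (hT : SmoothTensor J T) (hT' : SmoothTensor I (pullTensor I J ι T)) {X : VectorField I N}
    (hX : SmoothField I X) (p : N) (u v : TangentSpace I p) :
    lieTensor I X (pullTensor I J ι T) p u v =
      pullLie I J ι (fun q => mfderiv I J ι q (X q)) T p u v := by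
  have hψ := contDiffAt_writtenInExtChartAt hι p
  have hψ' := ((hψ.fderiv_right (m := 1) (by exact WithTop.coe_le_coe.2 le_top)).differentiableAt
    (by simp)).hasFDerivAt
  -- Second derivatives B of ι enter both sides: as B(X, u) from differentiating the pulled-back
  -- components, and as B(u, X) from differentiating ι_⋆ X. Their symmetry is the reason for
  -- naturality.
  have hsymm : IsSymmSndFDerivAt ℝ (writtenInExtChartAt I J p ι) (extChartAt I p p) :=
    hψ.isSymmSndFDerivAt (by simp; exact WithTop.coe_le_coe.2 le_top)
  have hG := hasFDerivAt_comp_writtenInExtChartAt (F := E' →L[ℝ] E' →L[ℝ] ℝ) hι p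
    (hT.differentiableWithinAt (ι p))
  have hξ := differentiableWithinAt_coordField (hX p)
  have hP := hT'.differentiableWithinAt p
  have hA : ∀ w, toCoord J (ι p) (ι p) (mfderiv I J ι p w) =
      fderiv ℝ (writtenInExtChartAt I J p ι) (extChartAt I p p) (toCoord I p p w) :=
    toCoord_mfderiv hι (mem_chart_source H p) (mem_chart_source H' (ι p))
  set y₀ := extChartAt I p p with hy₀
  set A := fderiv ℝ (writtenInExtChartAt I J p ι) y₀
  set B := fderiv ℝ (fderiv ℝ (writtenInExtChartAt I J p ι)) y₀
  have hpart : ∀ a b c, partialTensor I (pullTensor I J ι T) p a b c =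
      partialTensor J T (ι p) (A a) (A b) (A c) +
        coordTensor J (ι p) T (extChartAt J (ι p) (ι p)) (B a b) (A c) +
        coordTensor J (ι p) T (extChartAt J (ι p) (ι p)) (A b) (B a c) := fun a b c => by
    rw [I.range_eq_univ, differentiableWithinAt_univ] at hP
    rw [partialTensor, I.range_eq_univ, fderivWithin_univ]
    -- Freezing the constant vectors b and c reduces the derivative of a tensor-valued map to that
    -- of a scalar function, to which the product rule applies.
    have e1 := fderiv_bilin_apply hP.hasFDerivAt (hasFDerivAt_const b y₀)
      (hasFDerivAt_const c y₀) a
    simp only [zero_apply, map_zero, add_zero] at e1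
    rw [← e1]
    have e2 : (fun y => coordTensor I p (pullTensor I J ι T) y b c) =ᶠ[𝓝 y₀]
        fun y => coordTensor J (ι p) T (writtenInExtChartAt I J p ι y)
          (fderiv ℝ (writtenInExtChartAt I J p ι) y b)
          (fderiv ℝ (writtenInExtChartAt I J p ι) y c) := by
      filter_upwards [coordTensor_pullTensor hι T p] with y hy
      rw [hy, bicomp_apply]
    rw [e2.fderiv_eq, fderiv_bilin_apply hG (hψ'.clm_apply (hasFDerivAt_const b _))
      (hψ'.clm_apply (hasFDerivAt_const c _)) a, hy₀, writtenInExtChartAt_self]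
    simp only [add_apply, ContinuousLinearMap.comp_apply, zero_apply, map_zero, zero_add,
      ContinuousLinearMap.flip_apply]
    rfl
  have hal : ∀ a, partialAlong I J ι (fun q => mfderiv I J ι q (X q)) p a =
      B a (toCoord I p p (X p)) + A (partialField I X p a) := fun a => by
    rw [I.range_eq_univ, differentiableWithinAt_univ] at hξ
    rw [partialAlong, partialField, I.range_eq_univ, fderivWithin_univ, fderivWithin_univ,
      Filter.EventuallyEq.fderiv_eq (coordAlong_mfderiv hι X p), fderiv_lin_apply hψ' hξ.hasFDerivAt a,
      coordField_self]
  have hbase : ∀ a b, coordTensor I p (pullTensor I J ι T) y₀ a b =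
      coordTensor J (ι p) T (extChartAt J (ι p) (ι p)) (A a) (A b) :=
    fun a b => by
      rw [(coordTensor_pullTensor hι T p).self_of_nhds, bicomp_apply, writtenInExtChartAt_self]
  rw [lieTensor_eq, pullLie_eq, hpart, hal, hal, hbase, hbase, hA, hA, hA,
    show B (toCoord I p p u) (toCoord I p p (X p)) = B (toCoord I p p (X p)) (toCoord I p p u) from
      hsymm _ _,
    show B (toCoord I p p v) (toCoord I p p (X p)) = B (toCoord I p p (X p)) (toCoord I p p v) from
      hsymm _ _]
  simp only [map_add, add_apply]
  ring

/-- For a field along ι that extends to X on M, the chain rule turns the derivatives of its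
components along N into derivatives of the components of X, so `pullLie` agrees with the pull-back
of the genuine Lie derivative. -/
theorem pullLie_comp {ι : N → M} (hι : ContMDiff I J ∞ ι) (T : TwoTensor J M)
    {X : VectorField J M} (hX : SmoothField J X) (p : N) (u v : TangentSpace I p) :
    pullLie I J ι (fun q => X (ι q)) T p u v =
      lieTensor J X T (ι p) (mfderiv I J ι p u) (mfderiv I J ι p v) := by
  have hA : ∀ w, toCoord J (ι p) (ι p) (mfderiv I J ι p w) =
      fderiv ℝ (writtenInExtChartAt I J p ι) (extChartAt I p p) (toCoord I p p w) :=
    toCoord_mfderiv hι (mem_chart_source H p) (mem_chart_source H' (ι p))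
  have hal : ∀ w : TangentSpace I p, partialAlong I J ι (fun q => X (ι q)) p (toCoord I p p w) =
      partialField J X (ι p) (toCoord J (ι p) (ι p) (mfderiv I J ι p w)) := fun w => by
    have e : coordAlong I J ι (fun q => X (ι q)) p =ᶠ[𝓝 (extChartAt I p p)]
        fun y => coordField J (ι p) X (writtenInExtChartAt I J p ι y) := by
      filter_upwards [eventually_mem_charts (I := I) (H' := H') hι.continuous p]
        with y ⟨h1, h2, h3⟩
      have hιy : (extChartAt J (ι p)).symm (writtenInExtChartAt I J p ι y) =
        ι ((extChartAt I p).symm y) := (extChartAt J (ι p)).left_inv (by simpa using h3)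
      rw [coordField, hιy, coordAlong]
    rw [partialAlong, I.range_eq_univ, fderivWithin_univ, e.fderiv_eq,
      (hasFDerivAt_comp_writtenInExtChartAt hι p
        (differentiableWithinAt_coordField (hX (ι p)))).fderiv, hA]
    rfl
  rw [lieTensor_eq, pullLie_eq, hal, hal]

set_option synthInstance.maxHeartbeats 200000 in
theorem pullLie_add (ι : N → M) {ζ ζ' : FieldAlong J ι} (T : TwoTensor J M) (p : N)
    (hζ : DifferentiableAt ℝ (coordAlong I J ι ζ p) (extChartAt I p p))
    (hζ' : DifferentiableAt ℝ (coordAlong I J ι ζ' p) (extChartAt I p p))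
    (u v : TangentSpace I p) :
    pullLie I J ι (fun q => ζ q + ζ' q) T p u v =
      pullLie I J ι ζ T p u v + pullLie I J ι ζ' T p u v := by
  have e : coordAlong I J ι (fun q => ζ q + ζ' q) p =
      fun y => coordAlong I J ι ζ p y + coordAlong I J ι ζ' p y := by
    ext1 y; simp only [coordAlong, map_add]
  have h : partialAlong I J ι (fun q => ζ q + ζ' q) p =
      partialAlong I J ι ζ p + partialAlong I J ι ζ' p := by
    simp only [partialAlong, I.range_eq_univ, fderivWithin_univ]
    rw [e, fderiv_fun_add hζ hζ']
  simp only [pullLie_eq, h, map_add, add_apply]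
  ring

set_option synthInstance.maxHeartbeats 200000 in
-- Only the derivatives of the components of ζ see the derivative of z. Each of the two terms
-- containing them contributes one dz term contracted with g(ζ, ·).
theorem pullLie_smul (ι : N → M) {ζ : FieldAlong J ι} (T : TwoTensor J M) (p : N) {z : N → ℝ}
    (hz : ContMDiffAt I 𝓘(ℝ, ℝ) ∞ z p)
    (hζ : DifferentiableAt ℝ (coordAlong I J ι ζ p) (extChartAt I p p))
    (u v : TangentSpace I p) :
    pullLie I J ι (fun q => z q • ζ q) T p u v = z p * pullLie I J ι ζ T p u v +
      mvfderiv I z p u * T (ι p) (ζ p) (mfderiv I J ι p v) +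
      mvfderiv I z p v * T (ι p) (mfderiv I J ι p u) (ζ p) := by
  have e : coordAlong I J ι (fun q => z q • ζ q) p =
      fun y => z ((extChartAt I p).symm y) • coordAlong I J ι ζ p y := by
    ext1 y; simp only [coordAlong, map_smul]
  have hz' := differentiableWithinAt_comp_symm hz
  rw [I.range_eq_univ, differentiableWithinAt_univ] at hz'
  have hself : coordAlong I J ι ζ p (extChartAt I p p) = toCoord J (ι p) (ι p) (ζ p) := by
    rw [coordAlong, extChartAt_to_inv]
  have h : ∀ w : TangentSpace I p, partialAlong I J ι (fun q => z q • ζ q) p (toCoord I p p w) =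
      z p • partialAlong I J ι ζ p (toCoord I p p w) +
        mvfderiv I z p w • toCoord J (ι p) (ι p) (ζ p) := fun w => by
    rw [mvfderiv_eq hz]
    simp only [partialAlong, I.range_eq_univ, fderivWithin_univ]
    rw [e, fderiv_fun_smul hz' hζ, hself, extChartAt_to_inv]
    rfl
  simp only [pullLie_eq, h, map_add, map_smul, add_apply,
    smul_apply, smul_eq_mul, coordTensor_self]
  ring

end LieDerivative

/-! ### Partial derivatives as functions of tangent vectors at the centre of the chart. -/

section ChartDerivatives

variable {E : Type*} [NormedAddCommGroup E] [NormedSpace ℝ E]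
  {H : Type*} [TopologicalSpace H] (I : ModelWithCorners ℝ E H)
  {N : Type*} [TopologicalSpace N] [ChartedSpace H N] [IsManifold I ∞ N]

/-- `u^a v^b ∂_a θ_b` in the chart around `p`. -/
def dForm (θ : OneForm I N) (p : N) (u v : TangentSpace I p) : ℝ :=
  partialForm I θ p (toCoord I p p u) (toCoord I p p v)

/-- `u^a v^b w^c ∂_a T_bc` in the chart around `p`. -/
def dTensor (T : TwoTensor I N) (p : N) (u v w : TangentSpace I p) : ℝ :=
  partialTensor I T p (toCoord I p p u) (toCoord I p p v) (toCoord I p p w)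

/-- The vector with components `u^a ∂_a X^b` in the chart around `p`. -/
def dField (X : VectorField I N) (p : N) (u : TangentSpace I p) : TangentSpace I p :=
  ofCoord I p p (partialField I X p (toCoord I p p u))

variable {I}

theorem toCoord_dField (X : VectorField I N) (p : N) (u : TangentSpace I p) :
    toCoord I p p (dField I X p u) = partialField I X p (toCoord I p p u) :=
  toCoord_ofCoord (mem_chart_source H p) _

/-- `dForm`, `dTensor` and `dField` are not tensorial, but they take tangent vectors at p as
arguments. Coordinate identities thereby become linear relations between scalars. -/
theorem lieForm_eq_dForm (X : VectorField I N) (θ : OneForm I N) (p : N) (v : TangentSpace I p) :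
    lieForm I X θ p v = dForm I θ p (X p) v + θ p (dField I X p v) := by
  rw [← coordForm_self p θ (dField I X p v), toCoord_dField]
  rfl

theorem lieTensor_eq_dTensor (X : VectorField I N) (T : TwoTensor I N) (p : N)
    (u v : TangentSpace I p) :
    lieTensor I X T p u v =
      dTensor I T p (X p) u v + T p (dField I X p u) v + T p u (dField I X p v) := by
  rw [← coordTensor_self p T (dField I X p u), ← coordTensor_self p T u, toCoord_dField,
    toCoord_dField]
  rfl

variable [I.Boundaryless]

/-- `u(z (η + T(V, ·))) = u(ℓ)` in components. -/
theorem dForm_of_eq_smul_add {z : N → ℝ} {η ell : OneForm I N} {T : TwoTensor I N}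
    {V : VectorField I N} {p : N} (hz : ContMDiffAt I 𝓘(ℝ, ℝ) ∞ z p)
    (hη : DifferentiableAt ℝ (coordForm I p η) (extChartAt I p p))
    (hT : SmoothTensor I T)
    (hV : ContMDiffAt I I.tangent ∞ (fun p => (⟨p, V p⟩ : TangentBundle I N)) p)
    (h : ∀ q, ell q = z q • (η q + T q (V q))) (u v : TangentSpace I p) :
    mvfderiv I z p u * (η p v + T p (V p) v) +
      z p * (dForm I η p u v + dTensor I T p u (V p) v + T p (dField I V p u) v) =
      dForm I ell p u v := by
  have hz' := differentiableWithinAt_comp_symm hz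
  have hT' := hT.differentiableWithinAt p
  have hV' := differentiableWithinAt_coordField hV
  rw [I.range_eq_univ, differentiableWithinAt_univ] at hz' hT' hV'
  have e : coordForm I p ell =ᶠ[𝓝 (extChartAt I p p)] fun y =>
      z ((extChartAt I p).symm y) •
        (coordForm I p η y + coordTensor I p T y (coordField I p V y)) := by
    filter_upwards [extChartAt_target_mem_nhds (I := I) p] with y hy
    ext w
    rw [coordForm_apply, h]
    simp only [smul_apply, add_apply, coordForm_apply, coordTensor_apply, coordField]
    rw [ofCoord_toCoord]
    simpa using (extChartAt I p).map_target hy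
  have hTV := hT'.hasFDerivAt.clm_apply hV'.hasFDerivAt
  symm
  rw [dForm, partialForm, I.range_eq_univ, fderivWithin_univ, e.fderiv_eq,
    (hz'.hasFDerivAt.fun_smul (hη.hasFDerivAt.fun_add hTV)).fderiv, mvfderiv_eq hz, ← coordForm_self p η,
    ← coordTensor_self p T (V p), ← coordTensor_self p T _ v, toCoord_dField, coordField_self]
  simp only [dForm, dTensor, partialForm, partialTensor, partialField, I.range_eq_univ,
    fderivWithin_univ, extChartAt_to_inv]
  simp
  ring

/-- `u(θ(X))` in components. -/
theorem mvfderiv_apply_field {f : N → ℝ} {θ : OneForm I N} {X : VectorField I N} {p : N}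
    (hf : ContMDiffAt I 𝓘(ℝ, ℝ) ∞ f p)
    (hθ : DifferentiableAt ℝ (coordForm I p θ) (extChartAt I p p))
    (hX : ContMDiffAt I I.tangent ∞ (fun p => (⟨p, X p⟩ : TangentBundle I N)) p)
    (h : ∀ q, f q = θ q (X q)) (u : TangentSpace I p) :
    mvfderiv I f p u = dForm I θ p u (X p) + θ p (dField I X p u) := by
  have hX' := differentiableWithinAt_coordField hX
  rw [I.range_eq_univ, differentiableWithinAt_univ] at hX'
  have e : (fun y => f ((extChartAt I p).symm y)) =ᶠ[𝓝 (extChartAt I p p)] fun y =>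
      coordForm I p θ y (coordField I p X y) := by
    filter_upwards [extChartAt_target_mem_nhds (I := I) p] with y hy
    rw [coordForm_coordField θ X hy, h]
  rw [mvfderiv_eq hf, I.range_eq_univ, fderivWithin_univ, e.fderiv_eq,
    fderiv_lin_apply hθ.hasFDerivAt hX'.hasFDerivAt, ← coordForm_self p θ, toCoord_dField,
    coordField_self]
  simp only [dForm, partialForm, partialField, I.range_eq_univ, fderivWithin_univ]

theorem differentiableAt_coordForm_pullForm {E' : Type*} [NormedAddCommGroup E']
    [NormedSpace ℝ E'] {H' : Type*} [TopologicalSpace H'] {J : ModelWithCorners ℝ E' H'}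
    {M : Type*} [TopologicalSpace M] [ChartedSpace H' M] [IsManifold J ∞ M]
    {ι : N → M} (hι : ContMDiff I J ∞ ι) {θ : OneForm J M} (hθ : SmoothForm J θ) (p : N) :
    DifferentiableAt ℝ (coordForm I p (pullForm I J ι θ)) (extChartAt I p p) := by
  have hψ := contDiffAt_writtenInExtChartAt hι p
  have hψ' := (hψ.fderiv_right (m := 1) (by exact WithTop.coe_le_coe.2 le_top)).differentiableAt
    (by simp)
  have hG := hasFDerivAt_comp_writtenInExtChartAt (F := E' →L[ℝ] ℝ) hι p
    (hθ.differentiableWithinAt (ι p))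
  exact (hG.differentiableAt.clm_comp hψ').congr_of_eventuallyEq (coordForm_pullForm hι θ p)

end ChartDerivatives

/-! ### The zero covector field. -/

section Zero

variable {E : Type*} [NormedAddCommGroup E] [NormedSpace ℝ E]
  {H : Type*} [TopologicalSpace H] {I : ModelWithCorners ℝ E H}
  {N : Type*} [TopologicalSpace N] [ChartedSpace H N] [IsManifold I ∞ N]

theorem coordForm_zero (p : N) : coordForm I p (fun _ => 0) = fun _ => 0 := rfl

theorem dForm_zero (p : N) (u v : TangentSpace I p) : dForm I (fun _ => 0) p u v = 0 := by
  simp [dForm, partialForm, coordForm_zero]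

end Zero

/-! ### Null data: the connection ∇°, the tensor U and derivatives of n. -/

section DataIdentities

variable {m : ℕ} {N : Type*} [TopologicalSpace N]
  [ChartedSpace (EuclideanSpace ℝ (Fin (m + 1))) N] [IsManifold (𝓡 (m + 1)) ∞ N]

omit [IsManifold (𝓡 (m + 1)) ∞ N] in
theorem mvfderiv_const_eq_zero (c : ℝ) (p : N) (u : TangentSpace (𝓡 (m + 1)) p) :
    mvfderiv (𝓡 (m + 1)) (fun _ : N => c) p u = 0 := by
  simp [mvfderiv, mfderiv_const]

theorem dTensor_symm {T : TwoTensor (𝓡 (m + 1)) N} (hT : ∀ p u v, T p u v = T p v u) (p : N)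
    (u v w : TangentSpace (𝓡 (m + 1)) p) :
    dTensor (𝓡 (m + 1)) T p u v w = dTensor (𝓡 (m + 1)) T p u w v :=
  partialTensor_symm T hT p _ _ _

namespace MetricHypersurfaceData

variable (D : MetricHypersurfaceData m N)

theorem F_apply (p : N) (u v : TangentSpace (𝓡 (m + 1)) p) :
    D.F p u v = (1 / 2 : ℝ) * (dForm _ D.ell p u v - dForm _ D.ell p v u) := rfl

theorem firstKind_apply (p : N) (u v w : TangentSpace (𝓡 (m + 1)) p) :
    D.firstKind p u v w =
      (1 / 2 : ℝ) * (dTensor _ D.γ p u v w + dTensor _ D.γ p v u w - dTensor _ D.γ p w u v) := rfl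

theorem christoffel_eq (p : N) (u v : TangentSpace (𝓡 (m + 1)) p) :
    D.christoffel p u v = D.P p (D.firstKind p u v) +
      ((1 / 2 : ℝ) * (dForm _ D.ell p u v + dForm _ D.ell p v u)) • D.n p := rfl

theorem symNablaForm_eq (η : OneForm (𝓡 (m + 1)) N) (p : N)
    (u v : TangentSpace (𝓡 (m + 1)) p) :
    D.symNablaForm η p u v = (1 / 2 : ℝ) * ((dForm _ η p u v - η p (D.christoffel p u v)) +
      (dForm _ η p v u - η p (D.christoffel p v u))) := rfl

theorem γ_P (p : N) (α : TangentSpace (𝓡 (m + 1)) p →L[ℝ] ℝ) (w : TangentSpace (𝓡 (m + 1)) p) :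
    D.γ p (D.P p α) w = α w - D.ell p w * α (D.n p) := by
  obtain ⟨-, -, -, h4⟩ := D.relations p
  have e := congrArg α (h4 w)
  rw [map_add, map_smul, smul_eq_mul] at e
  rw [D.γ_symm, D.P_symm]
  linear_combination e

/-- The relation P^{ab} γ_bc + n^a ℓ_c = δ^a_c reconstructs a vector from its contractions with γ
and ℓ. The vector identities for n, V, Γ and φ_⋆ n below are checked on these two contractions. -/
theorem eq_of_γ_ell_eq (p : N) {u v : TangentSpace (𝓡 (m + 1)) p} (hγ : D.γ p u = D.γ p v)
    (hell : D.ell p u = D.ell p v) : u = v := by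
  obtain ⟨-, -, -, h4⟩ := D.relations p
  rw [← h4 u, ← h4 v, hγ, hell]

namespace IsNull

variable {D} (hD : D.IsNull)
include hD

theorem γ_n (p : N) : D.γ p (D.n p) = 0 := by
  ext u; simpa [hD p] using (D.relations p).1 u

theorem γ_n' (p : N) (u : TangentSpace (𝓡 (m + 1)) p) : D.γ p u (D.n p) = 0 := by
  rw [D.γ_symm, hD.γ_n]; rfl

theorem ell_n (p : N) : D.ell p (D.n p) = 1 := by
  simpa [hD p] using (D.relations p).2.1

theorem U_apply (p : N) (u v : TangentSpace (𝓡 (m + 1)) p) :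
    D.U p u v = (1 / 2 : ℝ) * (dTensor _ D.γ p (D.n p) u v + D.γ p (dField _ D.n p u) v +
      D.γ p u (dField _ D.n p v)) := by
  have h : D.n2 = fun _ => 0 := funext hD
  rw [D.U_apply, h, mvfderiv_const_eq_zero, mvfderiv_const_eq_zero, lieTensor_eq_dTensor]
  ring

section

variable {p : N}
  (hn : ContMDiffAt (𝓡 (m + 1)) (𝓡 (m + 1)).tangent ∞
    (fun p => (⟨p, D.n p⟩ : TangentBundle (𝓡 (m + 1)) N)) p)
include hn

theorem dTensor_γ_n (u v : TangentSpace (𝓡 (m + 1)) p) :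
    dTensor _ D.γ p u (D.n p) v + D.γ p (dField _ D.n p u) v = 0 := by
  -- Differentiates γ(n, ·) = 0, read as the gauge relation with z = 1, V = n and both covectors
  -- zero.
  have := dForm_of_eq_smul_add (I := 𝓡 (m + 1)) (z := fun _ => 1) (η := fun _ => 0)
    (ell := fun _ => 0) (p := p) contMDiffAt_const (by
      rw [coordForm_zero]; exact differentiableAt_const _) D.γ_smooth hn
    (fun q => by rw [hD.γ_n]; simp) u v
  rw [mvfderiv_const_eq_zero, dForm_zero] at this
  linear_combination this

/-- The derivative of ℓ(n) = 1. -/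
theorem dForm_ell_n (u : TangentSpace (𝓡 (m + 1)) p) :
    dForm _ D.ell p u (D.n p) + D.ell p (dField _ D.n p u) = 0 := by
  have h := D.ell_smooth.differentiableWithinAt p
  rw [(𝓡 (m + 1)).range_eq_univ, differentiableWithinAt_univ] at h
  rw [← mvfderiv_apply_field (f := fun _ => 1) contMDiffAt_const h hn
    (fun q => (hD.ell_n q).symm), mvfderiv_const_eq_zero]

/-- With n in the first slot of £_n γ, the first two terms form the derivative of γ(n, ·) = 0 along
n, and the third contains γ(n, ·). -/
theorem U_n (v : TangentSpace (𝓡 (m + 1)) p) : D.U p (D.n p) v = 0 := by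
  rw [hD.U_apply, hD.dTensor_γ_n hn, hD.γ_n]
  simp

theorem firstKind_n (u v : TangentSpace (𝓡 (m + 1)) p) :
    D.firstKind p u v (D.n p) = -D.U p u v := by
  rw [firstKind_apply, hD.U_apply, dTensor_symm D.γ_symm p u v, dTensor_symm D.γ_symm p v u,
    D.γ_symm p u]
  linear_combination (1 / 2 : ℝ) * (hD.dTensor_γ_n hn u v + hD.dTensor_γ_n hn v u)

/-- With `ell_christoffel`, this recovers the content of the defining equations of ∇° from the
explicit coefficients. The correction U ⊗ ℓ appears because γP = δ - ℓ ⊗ n, while the first-kind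
symbol contracted with n is -U. -/
theorem γ_christoffel (u v w : TangentSpace (𝓡 (m + 1)) p) :
    D.γ p (D.christoffel p u v) w = D.firstKind p u v w + D.U p u v * D.ell p w := by
  rw [christoffel_eq, map_add, map_smul, hD.γ_n, add_apply, D.γ_P, hD.firstKind_n hn]
  simp
  ring

theorem ell_christoffel (u v : TangentSpace (𝓡 (m + 1)) p) :
    D.ell p (D.christoffel p u v) =
      (1 / 2 : ℝ) * (dForm _ D.ell p u v + dForm _ D.ell p v u) + D.ell2 p * D.U p u v := by
  have h := (D.relations p).2.2.1 (D.firstKind p u v)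
  rw [hD.firstKind_n hn] at h
  rw [christoffel_eq, map_add, map_smul, hD.ell_n, smul_eq_mul]
  linear_combination h

/-- `∇°_u n = s(u) n + P(U(u, ·), ·)`. -/
theorem christoffel_n (u : TangentSpace (𝓡 (m + 1)) p) :
    dField _ D.n p u + D.christoffel p (D.n p) u = D.s p u • D.n p + D.P p (D.U p u) := by
  have hU : D.U p u (D.n p) = 0 := by rw [D.U_symm, hD.U_n hn]
  refine D.eq_of_γ_ell_eq p ?_ ?_
  · ext w
    rw [map_add, map_add, map_smul, hD.γ_n, add_apply, add_apply, D.γ_P, hD.γ_christoffel hn,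
      firstKind_apply, hU, hD.U_n hn, hD.U_apply, dTensor_symm D.γ_symm p w, D.γ_symm p u]
    have h1 := hD.dTensor_γ_n hn u w
    have h2 := hD.dTensor_γ_n hn w u
    rw [dTensor_symm D.γ_symm p w (D.n p)] at h2
    simp
    linear_combination (1 / 2 : ℝ) * (h1 - h2)
  · have h1 := hD.dForm_ell_n hn u
    have h2 := (D.relations p).2.2.1 (D.U p u)
    rw [hU] at h2
    rw [map_add, map_add, map_smul, hD.ell_n, hD.ell_christoffel hn, hD.U_n hn, smul_eq_mul,
      MetricHypersurfaceData.s, F_apply]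
    linear_combination h1 - h2

/-- The Lie derivative of `γ` along a vector field `V` with `ℓ = z (η + γ(V, ·))`. -/
theorem lieTensor_γ {z : N → ℝ} {η : OneForm (𝓡 (m + 1)) N} {V : VectorField (𝓡 (m + 1)) N}
    (hz : ContMDiffAt (𝓡 (m + 1)) 𝓘(ℝ, ℝ) ∞ z p)
    (hη : DifferentiableAt ℝ (coordForm (𝓡 (m + 1)) p η) (extChartAt (𝓡 (m + 1)) p p))
    (hV : SmoothField (𝓡 (m + 1)) V)
    (h : ∀ q, D.ell q = z q • (η q + D.γ q (V q))) (u v : TangentSpace (𝓡 (m + 1)) p) :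
    z p * lieTensor (𝓡 (m + 1)) V D.γ p u v =
      -(mvfderiv (𝓡 (m + 1)) z p u * (η p v + D.γ p (V p) v) +
        mvfderiv (𝓡 (m + 1)) z p v * (η p u + D.γ p (V p) u)) -
      2 * z p * D.symNablaForm η p u v + 2 * (z p * D.ell p (V p) - D.ell2 p) * D.U p u v := by
  have R := dForm_of_eq_smul_add hz hη D.γ_smooth (hV p) h
  have hG : ∀ x, D.ell p x = z p * (η p x + D.γ p x (V p)) := fun x => by
    rw [h p, D.γ_symm p x]; rfl
  have e1 := hD.γ_christoffel hn u v (V p)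
  have e2 := hD.γ_christoffel hn v u (V p)
  have e3 := hD.ell_christoffel hn u v
  have e4 := hD.ell_christoffel hn v u
  have s := dTensor_symm D.γ_symm p (V p) u v
  have s1 := dTensor_symm D.γ_symm p u (V p) v
  have s2 := dTensor_symm D.γ_symm p v (V p) u
  rw [firstKind_apply] at e1 e2
  rw [D.U_symm p v u] at e2 e4
  rw [hG (D.christoffel p u v)] at e3
  rw [hG (D.christoffel p v u)] at e4
  rw [lieTensor_eq_dTensor, symNablaForm_eq, D.γ_symm p u]
  -- The gauge relation is differentiated along u and v and symmetrized. The values of ℓ, η and γ(V,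
  -- ·) on Γ(u, v) combine by applying ℓ = z (η + γ(V, ·)) to Γ itself, leaving ∇°η and the U terms
  -- of the two connection identities.
  linear_combination R u v + R v u - e3 - e4 + z p * (e1 + e2) + (1 / 2 : ℝ) * z p * s - z p * s1 -
    z p * s2

end

end IsNull

end MetricHypersurfaceData

end DataIdentities

/-! ### Energy-momentum tensor in a frame adapted to n. -/

section Frame

variable {m : ℕ} {N : Type*} [TopologicalSpace N]
  [ChartedSpace (EuclideanSpace ℝ (Fin (m + 1))) N] [IsManifold (𝓡 (m + 1)) ∞ N]

section DualBasis

variable {R T : Type*} [CommRing R] [AddCommGroup T] [Module R T]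
  {b : Module.Basis (Fin (m + 1)) R T} {n : T} {e : Fin m → T}
  (hb : ∀ i, b i = (Fin.cons n e : Fin (m + 1) → T) i)
  {ν : T →ₗ[R] R} {θ : Fin m → T →ₗ[R] R}
  (hνn : ν n = 1) (hνe : ∀ A, ν (e A) = 0) (hθn : ∀ A, θ A n = 0)
  (hθe : ∀ A B, θ A (e B) = if A = B then 1 else 0)
include hb hνn hνe hθn hθe

theorem dualBasis_expansion (x : T) : ν x • n + ∑ B, θ B x • e B = x := by
  have : ν.smulRight n + ∑ B, (θ B).smulRight (e B) = LinearMap.id := by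
    refine b.ext fun i => ?_
    rw [hb]
    refine Fin.cases ?_ (fun A => ?_) i
    · simp [hνn, hθn]
    · simp [hνe, hθe]
  simpa using congrArg (fun f : T →ₗ[R] T => f x) this

/-- ν and θ^A agree with the coordinate functionals of the basis, so the sum is that of the diagonal
matrix entries. -/
theorem trace_eq_dualBasis (f : T →ₗ[R] T) :
    LinearMap.trace R T f = ν (f n) + ∑ A, θ A (f (e A)) := by
  have h0 : b.coord 0 = ν := b.ext fun i => by
    rw [b.coord_apply, b.repr_self, hb]
    refine Fin.cases ?_ (fun A => ?_) i
    · simp [hνn]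
    · simp [hνe]
  have hs : ∀ A : Fin m, b.coord A.succ = θ A := fun A => b.ext fun i => by
    rw [b.coord_apply, b.repr_self, hb]
    refine Fin.cases ?_ (fun B => ?_) i
    · simp [hθn]
    · simp [hθe, Finsupp.single_apply, eq_comm]
  rw [LinearMap.trace_eq_matrix_trace R b, Matrix.trace, Fin.sum_univ_succ]
  simp only [Matrix.diag_apply, LinearMap.toMatrix_apply, ← b.coord_apply, h0, hs, hb,
    Fin.cons_zero, Fin.cons_succ]

end DualBasis

namespace MetricHypersurfaceData

variable (D : MetricHypersurfaceData m N)

/-- The (θ, θ) and (ν, θ) components follow by expanding P(θ^A, ·) in the frame. In the (ν, ν)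
component, the trace P^{ab}[Y]_ab equals 2 [Y](P(ν, ·), n) - P(ν, ν) [Y](n, n) + 𝔥^{AB} [Y](e_A,
e_B), so only the last term survives. -/
theorem energyMomentum_frame (hD : D.IsNull) (ε : ℝ) (jY : TwoTensor (𝓡 (m + 1)) N) (p : N)
    (hjY : ∀ u v, jY p u v = jY p v u)
    {b : Module.Basis (Fin (m + 1)) ℝ (TangentSpace (𝓡 (m + 1)) p)}
    {e : Fin m → TangentSpace (𝓡 (m + 1)) p}
    (hb : ∀ i, b i = (Fin.cons (D.n p) e : Fin (m + 1) → TangentSpace (𝓡 (m + 1)) p) i)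
    {ν : TangentSpace (𝓡 (m + 1)) p →L[ℝ] ℝ} {θ : Fin m → TangentSpace (𝓡 (m + 1)) p →L[ℝ] ℝ}
    (hνn : ν (D.n p) = 1) (hνe : ∀ A, ν (e A) = 0) (hθn : ∀ A, θ A (D.n p) = 0)
    (hθe : ∀ A B, θ A (e B) = if A = B then 1 else 0) :
    let hinv : Matrix (Fin m) (Fin m) ℝ := (Matrix.of fun A B => D.γ p (e A) (e B))⁻¹
    D.energyMomentum ε jY p ν ν = -ε * ∑ A, ∑ B, hinv A B * jY p (e A) (e B) ∧
    (∀ A, D.energyMomentum ε jY p ν (θ A) = ε * ∑ B, hinv A B * jY p (D.n p) (e B)) ∧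
    (∀ A B, D.energyMomentum ε jY p (θ A) (θ B) = -ε * hinv A B * jY p (D.n p) (D.n p)) := by
  intro hinv
  have hexp : ∀ x, ν x • D.n p + ∑ B, θ B x • e B = x := fun x =>
    dualBasis_expansion (ν := ν.toLinearMap) (θ := fun A => (θ A).toLinearMap) hb hνn hνe hθn hθe x
  have hlin : ∀ (α : TangentSpace (𝓡 (m + 1)) p →L[ℝ] ℝ) x,
      α x = ν x * α (D.n p) + ∑ B, θ B x * α (e B) := fun α x => by
    conv_lhs => rw [← hexp x]
    simp
  have htr : ∀ f : TangentSpace (𝓡 (m + 1)) p →ₗ[ℝ] TangentSpace (𝓡 (m + 1)) p,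
      LinearMap.trace ℝ _ f = ν (f (D.n p)) + ∑ A, θ A (f (e A)) := fun f =>
    trace_eq_dualBasis (ν := ν.toLinearMap) (θ := fun A => (θ A).toLinearMap) hb hνn hνe hθn hθe f
  -- Expand γ(e_A, P(θ^C, ·)) in the frame: the n-term drops by nullity, and γP = δ - ℓ ⊗ n with
  -- θ^C(n) = 0 makes the value δ_A^C.
  have hh : hinv = Matrix.of fun A B => θ A (D.P p (θ B)) := by
    refine Matrix.inv_eq_right_inv ?_
    ext A C
    have h1 := hlin (D.γ p (e A)) (D.P p (θ C))
    rw [hD.γ_n', D.γ_symm, D.γ_P, hθn, hθe] at h1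
    simp only [Matrix.mul_apply, Matrix.of_apply, Matrix.one_apply]
    have h2 : (if A = C then (1 : ℝ) else 0) = if C = A then 1 else 0 := by simp only [eq_comm]
    simp only [mul_comm (D.γ p (e A) _)]
    linear_combination -h2 - h1
  have hPs : ∀ A B, θ A (D.P p (θ B)) = θ B (D.P p (θ A)) := fun A B => D.P_symm p _ _
  have hPν : ∀ A, ν (D.P p (θ A)) = θ A (D.P p ν) := fun A => D.P_symm p _ _
  have hn2 := hD p
  refine ⟨?_, fun A => ?_, fun A B => ?_⟩
  · have e1 : jY p (D.P p ν) (D.n p) = ν (D.P p ν) * jY p (D.n p) (D.n p) +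
        ∑ B, θ B (D.P p ν) * jY p (D.n p) (e B) := by
      rw [hjY]; exact hlin _ _
    have e2 : ∀ A, θ A (D.P p (jY p (e A))) = θ A (D.P p ν) * jY p (D.n p) (e A) +
        ∑ B, hinv A B * jY p (e A) (e B) := fun A => by
      rw [D.P_symm, hlin (jY p (e A)), hPν, hjY (e A) (D.n p), hh]
      congr 1
      exact Finset.sum_congr rfl fun B _ => by rw [Matrix.of_apply, hPs]
    have e3 : ν (D.P p (jY p (D.n p))) = jY p (D.P p ν) (D.n p) := by
      rw [D.P_symm, hjY]
    rw [energyMomentum, htr, hn2]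
    simp only [LinearMap.comp_apply, ContinuousLinearMap.coe_coe, e2, e3, e1, hνn,
      Finset.sum_add_distrib]
    ring
  · have e1 : jY p (D.P p (θ A)) (D.n p) = ν (D.P p (θ A)) * jY p (D.n p) (D.n p) +
        ∑ B, hinv A B * jY p (D.n p) (e B) := by
      rw [hjY, hlin (jY p (D.n p)), hh]
      congr 1
      exact Finset.sum_congr rfl fun B _ => by rw [Matrix.of_apply, hPs]
    rw [energyMomentum, hn2, e1, hνn, hθn]
    ring
  · rw [energyMomentum, hn2, hh, Matrix.of_apply, hθn, hθn]
    ring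

end MetricHypersurfaceData

end Frame

/-! ### Transport by the diffeomorphism, and gauge change of the rigging. -/

section Gluing

variable {m : ℕ} {N : Type*} [TopologicalSpace N]
  [ChartedSpace (EuclideanSpace ℝ (Fin (m + 1))) N] [IsManifold (𝓡 (m + 1)) ∞ N]
  (φ : N ≃ₘ^∞⟮𝓡 (m + 1), 𝓡 (m + 1)⟯ N)

/-- The derivative of a diffeomorphism at `p`. -/
def tangentEquiv (p : N) :
    TangentSpace (𝓡 (m + 1)) p ≃L[ℝ] TangentSpace (𝓡 (m + 1)) (φ p) :=
  φ.mfderivToContinuousLinearEquiv (by simp) p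

omit [IsManifold (𝓡 (m + 1)) ∞ N] in
theorem tangentEquiv_apply (p : N) (u : TangentSpace (𝓡 (m + 1)) p) :
    tangentEquiv φ p u = mfderiv (𝓡 (m + 1)) (𝓡 (m + 1)) φ p u := rfl

omit [IsManifold (𝓡 (m + 1)) ∞ N] in
theorem surjective_mfderiv (p : N) :
    Function.Surjective (mfderiv (𝓡 (m + 1)) (𝓡 (m + 1)) φ p) :=
  (tangentEquiv φ p).surjective

omit [IsManifold (𝓡 (m + 1)) ∞ N] in
-- The two tangent spaces sit at φ⁻¹(φ p) and p, which are equal only propositionally. The identity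
-- is therefore stated in the model space underlying both.
theorem mfderiv_symm_mfderiv (p : N) (u : TangentSpace (𝓡 (m + 1)) p) :
    (mfderiv (𝓡 (m + 1)) (𝓡 (m + 1)) φ.symm (φ p)
      (mfderiv (𝓡 (m + 1)) (𝓡 (m + 1)) φ p u) : EuclideanSpace ℝ (Fin (m + 1))) = u := by
  have h1 : MDifferentiableAt (𝓡 (m + 1)) (𝓡 (m + 1)) φ.symm (φ p) :=
    φ.symm.contMDiff.mdifferentiable (by simp) _
  have h2 : MDifferentiableAt (𝓡 (m + 1)) (𝓡 (m + 1)) φ p :=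
    φ.contMDiff.mdifferentiable (by simp) _
  have h := mfderiv_comp p h1 h2
  have hc : φ.symm ∘ φ = id := by ext q; simp
  rw [hc, mfderiv_id] at h
  exact congrArg (fun L : EuclideanSpace ℝ (Fin (m + 1)) →L[ℝ] EuclideanSpace ℝ (Fin (m + 1)) =>
    L u) h.symm

omit [IsManifold (𝓡 (m + 1)) ∞ N] in
theorem push_apply (X : VectorField (𝓡 (m + 1)) N) (p : N) :
    push φ X (φ p) = mfderiv (𝓡 (m + 1)) (𝓡 (m + 1)) φ p (X p) := by
  have h : mfderiv (𝓡 (m + 1)) (𝓡 (m + 1)) φ.symm (φ p) =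
    (tangentEquiv φ.symm (φ p)).toContinuousLinearMap := rfl
  have key : ∀ p', p' = p → (X p' : EuclideanSpace ℝ (Fin (m + 1))) = X p := by rintro _ rfl; rfl
  rw [push, VectorField.mpullback_apply, h, ContinuousLinearMap.inverse_equiv,
    ContinuousLinearEquiv.coe_coe, ContinuousLinearEquiv.symm_apply_eq, tangentEquiv_apply]
  exact (key _ (φ.symm_apply_apply p)).trans (mfderiv_symm_mfderiv φ p (X p)).symm

theorem push_smooth {X : VectorField (𝓡 (m + 1)) N} (hX : SmoothField (𝓡 (m + 1)) X) :
    SmoothField (𝓡 (m + 1)) (push φ X) :=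
  ContMDiff.mpullback_vectorField (n := ∞) hX φ.symm.contMDiff
    (fun q => ⟨tangentEquiv φ.symm q, rfl⟩) (by simp)

omit [IsManifold (𝓡 (m + 1)) ∞ N] in
theorem mvfderiv_comp_symm {z : N → ℝ} (hz : ContMDiff (𝓡 (m + 1)) 𝓘(ℝ, ℝ) ∞ z) (p : N)
    (u : TangentSpace (𝓡 (m + 1)) p) :
    mvfderiv (𝓡 (m + 1)) (fun q => z (φ.symm q)) (φ p)
      (mfderiv (𝓡 (m + 1)) (𝓡 (m + 1)) φ p u) = mvfderiv (𝓡 (m + 1)) z p u := by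
  have h1 : MDifferentiableAt (𝓡 (m + 1)) 𝓘(ℝ, ℝ) (fun q => z (φ.symm q)) (φ p) :=
    (hz.comp φ.symm.contMDiff).mdifferentiable (by simp) _
  have h2 : MDifferentiableAt (𝓡 (m + 1)) (𝓡 (m + 1)) φ p :=
    φ.contMDiff.mdifferentiable (by simp) _
  have h := mfderiv_comp p h1 h2
  have hc : (fun q => z (φ.symm q)) ∘ φ = z := by ext q; simp
  rw [hc] at h
  change _ = (mfderiv (𝓡 (m + 1)) 𝓘(ℝ, ℝ) z p : EuclideanSpace ℝ (Fin (m + 1)) →L[ℝ] ℝ) u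
  exact congrArg (fun L : EuclideanSpace ℝ (Fin (m + 1)) →L[ℝ] ℝ => L u) h.symm

/-- Both sides are the `pullLie` of the same field along φ: by naturality for dφ(X), and by
restriction for φ_⋆ X. -/
theorem lieTensor_push {X : VectorField (𝓡 (m + 1)) N} (hX : SmoothField (𝓡 (m + 1)) X)
    {T : TwoTensor (𝓡 (m + 1)) N} (hT : SmoothTensor (𝓡 (m + 1)) T)
    (hT' : SmoothTensor (𝓡 (m + 1)) (pullTensor (𝓡 (m + 1)) (𝓡 (m + 1)) φ T)) (p : N)
    (u v : TangentSpace (𝓡 (m + 1)) p) :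
    lieTensor (𝓡 (m + 1)) (push φ X) T (φ p) (mfderiv (𝓡 (m + 1)) (𝓡 (m + 1)) φ p u)
        (mfderiv (𝓡 (m + 1)) (𝓡 (m + 1)) φ p v) =
      lieTensor (𝓡 (m + 1)) X (pullTensor (𝓡 (m + 1)) (𝓡 (m + 1)) φ T) p u v := by
  rw [lieTensor_pullTensor φ.contMDiff hT hT' hX, ← pullLie_comp φ.contMDiff T (push_smooth φ hX)]
  congr 3
  exact funext fun q => push_apply φ X q

section AlongEmbedding

variable {M : Type*} [TopologicalSpace M]
  [ChartedSpace (EuclideanHalfSpace (m + 2)) M] [IsManifold (𝓡∂ (m + 2)) ∞ M]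

theorem differentiableAt_coordAlong_mfderiv {ι : N → M}
    (hι : ContMDiff (𝓡 (m + 1)) (𝓡∂ (m + 2)) ∞ ι) {X : VectorField (𝓡 (m + 1)) N}
    (hX : SmoothField (𝓡 (m + 1)) X) (p : N) :
    DifferentiableAt ℝ (coordAlong (𝓡 (m + 1)) (𝓡∂ (m + 2)) ι
      (fun q => mfderiv (𝓡 (m + 1)) (𝓡∂ (m + 2)) ι q (X q)) p)
      (extChartAt (𝓡 (m + 1)) p p) := by
  have hψ := contDiffAt_writtenInExtChartAt hι p
  have hψ' := (hψ.fderiv_right (m := 1) (by exact WithTop.coe_le_coe.2 le_top)).differentiableAt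
    (by simp)
  have hξ := differentiableWithinAt_coordField (hX p)
  rw [(𝓡 (m + 1)).range_eq_univ, differentiableWithinAt_univ] at hξ
  exact (hψ'.clm_apply hξ).congr_of_eventuallyEq (coordAlong_mfderiv hι X p)

/-- The change of `Y` under a gauge transformation `ζ ↦ z (ζ + ι_⋆ X)` of the rigging. -/
theorem pullLie_gauge {ι : N → M} {ζ : FieldAlong (𝓡∂ (m + 2)) ι} {G : LorentzMetric m M}
    {Dh : HypersurfaceData m N} (h : Dh.IsEmbedded G ι ζ) {z : N → ℝ}
    (hz : ContMDiff (𝓡 (m + 1)) 𝓘(ℝ, ℝ) ∞ z) {X : VectorField (𝓡 (m + 1)) N}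
    (hX : SmoothField (𝓡 (m + 1)) X) (q : N) (u v : TangentSpace (𝓡 (m + 1)) q) :
    pullLie (𝓡 (m + 1)) (𝓡∂ (m + 2)) ι
        (fun q => z q • (ζ q + mfderiv (𝓡 (m + 1)) (𝓡∂ (m + 2)) ι q (X q))) G.g q u v =
      z q * (2 * Dh.Y q u v + lieTensor (𝓡 (m + 1)) X Dh.γ q u v) +
      mvfderiv (𝓡 (m + 1)) z q u * (Dh.ell q v + Dh.γ q (X q) v) +
      mvfderiv (𝓡 (m + 1)) z q v * (Dh.ell q u + Dh.γ q (X q) u) := by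
  have hι := h.embedding.contMDiff
  have d1 := h.rigging.smooth.differentiableAt q
  have d2 := differentiableAt_coordAlong_mfderiv hι hX q
  have d12 : DifferentiableAt ℝ (coordAlong (𝓡 (m + 1)) (𝓡∂ (m + 2)) ι
      (fun q => ζ q + mfderiv (𝓡 (m + 1)) (𝓡∂ (m + 2)) ι q (X q)) q)
      (extChartAt (𝓡 (m + 1)) q q) := by
    refine (d1.add d2).congr_of_eventuallyEq (Filter.Eventually.of_forall fun y => ?_)
    simp only [coordAlong, map_add, Pi.add_apply]
  have hpull := h.γ_eq ▸ Dh.γ_smooth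
  rw [pullLie_smul ι G.g q (hz q) d12, pullLie_add ι G.g q d1 d2,
    ← lieTensor_pullTensor hι G.smooth hpull hX, ← h.γ_eq, h.Y_eq,
    G.symm _ _ (ζ q + mfderiv (𝓡 (m + 1)) (𝓡∂ (m + 2)) ι q (X q))]
  have hg : ∀ w, G.g (ι q) (ζ q + mfderiv (𝓡 (m + 1)) (𝓡∂ (m + 2)) ι q (X q))
      (mfderiv (𝓡 (m + 1)) (𝓡∂ (m + 2)) ι q w) = Dh.ell q w + Dh.γ q (X q) w := fun w => by
    rw [map_add, h.ell_eq, h.γ_eq]; rfl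
  rw [hg, hg]
  simp only [smul_apply, smul_eq_mul]
  ring

end AlongEmbedding

end Gluing

/-! ### Consequences of the matching conditions and the general jump formula. -/

section MatchedData

variable {m : ℕ} {N : Type*} [TopologicalSpace N]
  [ChartedSpace (EuclideanSpace ℝ (Fin (m + 1))) N] [IsManifold (𝓡 (m + 1)) ∞ N]
  {D Dh : HypersurfaceData m N} {φ : N ≃ₘ^∞⟮𝓡 (m + 1), 𝓡 (m + 1)⟯ N}

namespace MatchingConditions

variable {z : N → ℝ} {V : VectorField (𝓡 (m + 1)) N} {εp εm : ℝ}
  (h : MatchingConditions D Dh φ z V εp εm)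
include h

theorem ell_apply (p : N) : D.ell p = z p • (pullEll Dh φ p + D.γ p (V p)) := by
  have := congrFun h.ell_eq p
  rw [h.γ_eq] at this
  exact this.symm

theorem γ_apply (p : N) (u v : TangentSpace (𝓡 (m + 1)) p) :
    Dh.γ (φ p) (mfderiv (𝓡 (m + 1)) (𝓡 (m + 1)) φ p u)
      (mfderiv (𝓡 (m + 1)) (𝓡 (m + 1)) φ p v) = D.γ p u v :=
  congrArg (fun T : TangentSpace (𝓡 (m + 1)) p →L[ℝ] TangentSpace (𝓡 (m + 1)) p →L[ℝ] ℝ => T u v)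
    (congrFun h.γ_eq p)

theorem mul_pullEll_n (hD : D.IsNull) (p : N) : z p * pullEll Dh φ p (D.n p) = 1 := by
  have e := congrArg (fun L : TangentSpace (𝓡 (m + 1)) p →L[ℝ] ℝ => L (D.n p)) (h.ell_apply p)
  simp only [hD.ell_n, smul_apply, add_apply, hD.γ_n', smul_eq_mul, add_zero] at e
  exact e.symm

theorem eq_matchZ (hD : D.IsNull) : z = matchZ D Dh φ := by
  ext p
  exact eq_one_div_of_mul_eq_one_left (h.mul_pullEll_n hD p)

/-- The condition on ℓ gives γ(V, ·) = z⁻¹ℓ - η. The condition on ℓ⁽²⁾ then becomes linear in ℓ(V),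
since γ(V, V) and η(V) are expressible through ℓ(V), P(η, η) and ℓ⁽²⁾; its solution is the term with
μ. -/
theorem eq_matchV (hD : D.IsNull) : V = matchV D Dh φ := by
  ext1 p
  have hzn := h.mul_pullEll_n hD p
  have hγV : ∀ w, z p * (pullEll Dh φ p w + D.γ p (V p) w) = D.ell p w := fun w => by
    rw [h.ell_apply p]; rfl
  have hz := h.z_ne_zero p
  have hP := (D.relations p).2.2.1 (pullEll Dh φ p)
  refine D.eq_of_γ_ell_eq p ?_ ?_
  · ext w
    rw [matchV, map_add, map_neg, map_smul, hD.γ_n, smul_zero, add_zero, neg_apply, D.γ_P]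
    refine mul_left_cancel₀ hz ?_
    linear_combination hγV w - D.ell p w * hzn
  · have h2 : z p ^ 2 * (Dh.ell2 (φ p) + 2 * pullEll Dh φ p (V p) + D.γ p (V p) (V p)) =
        D.ell2 p := by
      have := congrFun h.ell2_eq p
      rw [h.γ_eq] at this
      exact this
    have h3 := hγV (V p)
    have h4 := hγV (D.P p (pullEll Dh φ p))
    rw [D.γ_symm, D.γ_P] at h4
    rw [matchV, map_add, map_neg, map_smul, hD.ell_n, matchMu, matchQ, smul_eq_mul, mul_one]
    have hz1 : pullEll Dh φ p (D.n p) = 1 / z p := eq_one_div_of_mul_eq_one_right hzn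
    rw [hz1] at h4 hP ⊢
    field_simp at h4 hP ⊢
    refine mul_left_cancel₀ hz ?_
    linear_combination h2 - z p * h3 - z p * h4 + hP

/-- As φ pulls γ̂ back to γ, it carries the radical of γ onto that of γ̂; contraction with ℓ̂ fixes
the factor. -/
theorem mfderiv_n (hD : D.IsNull) (hDh : Dh.IsNull) (p : N) :
    mfderiv (𝓡 (m + 1)) (𝓡 (m + 1)) φ p (D.n p) = pullEll Dh φ p (D.n p) • Dh.n (φ p) := by
  refine Dh.eq_of_γ_ell_eq (φ p) ?_ ?_
  · ext w
    obtain ⟨w', rfl⟩ := surjective_mfderiv φ p w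
    rw [h.γ_apply, hD.γ_n, map_smul, hDh.γ_n, smul_zero]
    rfl
  · rw [map_smul, hDh.ell_n, smul_eq_mul, mul_one]
    rfl

theorem covW_apply (e : VectorField (𝓡 (m + 1)) N) (p : N) :
    covW D φ e (φ p) = Dh.γ (φ p) (mfderiv (𝓡 (m + 1)) (𝓡 (m + 1)) φ p (e p)) := by
  ext w
  obtain ⟨w', rfl⟩ := surjective_mfderiv φ p w
  have key : ∀ p', p' = p → ∀ w : EuclideanSpace ℝ (Fin (m + 1)),
      D.γ p' (e p') w = D.γ p (e p) w := by
    rintro _ rfl w; rfl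
  rw [h.γ_apply]
  refine (key _ (φ.symm_apply_apply p) _).trans ?_
  exact congrArg (fun x : EuclideanSpace ℝ (Fin (m + 1)) => D.γ p (e p) x)
    (mfderiv_symm_mfderiv φ p w')

/-- The gauge relation shows that χ is ℓ̂(φ_⋆ e), the n̂-component of φ_⋆ e. In this form it no
longer involves V. -/
theorem chi_apply (hD : D.IsNull) (e : VectorField (𝓡 (m + 1)) N) (p : N) :
    chi D Dh φ e (φ p) = pullEll Dh φ p (e p) := by
  have key : ∀ p', p' = p → (matchZ D Dh φ p')⁻¹ * D.ell p' (e p') =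
      (matchZ D Dh φ p)⁻¹ * D.ell p (e p) := by
    rintro _ rfl; rfl
  have hz := h.z_ne_zero p
  have hell : D.ell p (e p) = z p * (pullEll Dh φ p (e p) + D.γ p (V p) (e p)) := by
    rw [h.ell_apply p]; rfl
  rw [chi, h.covW_apply, push_apply, h.γ_apply, ← h.eq_matchV hD, key _ (φ.symm_apply_apply p),
    ← h.eq_matchZ hD, D.γ_symm, hell]
  field_simp
  ring

theorem mfderiv_eq_vecW (hD : D.IsNull) (e : VectorField (𝓡 (m + 1)) N) (p : N) :
    mfderiv (𝓡 (m + 1)) (𝓡 (m + 1)) φ p (e p) =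
      vecW D Dh φ e (φ p) + chi D Dh φ e (φ p) • Dh.n (φ p) := by
  have h4 := (Dh.relations (φ p)).2.2.2 (mfderiv (𝓡 (m + 1)) (𝓡 (m + 1)) φ p (e p))
  rw [vecW, h.covW_apply, h.chi_apply hD]
  exact h4.symm

variable {Mp : Type*} [TopologicalSpace Mp] [ChartedSpace (EuclideanHalfSpace (m + 2)) Mp]
  [IsManifold (𝓡∂ (m + 2)) ∞ Mp] {Gp : LorentzMetric m Mp}
  {ιp : N → Mp} {Lp : FieldAlong (𝓡∂ (m + 2)) ιp}

omit [IsManifold (𝓡∂ (m + 2)) ∞ Mp] in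
theorem matchRigging_eq (hD : D.IsNull) :
    matchRigging D Dh φ ιp Lp = fun q => z (φ.symm q) •
      (Lp q + mfderiv (𝓡 (m + 1)) (𝓡∂ (m + 2)) ιp q (push φ V q)) := by
  ext1 q
  rw [matchRigging, h.eq_matchZ hD, h.eq_matchV hD]
  simp only [push, VectorField.mpullback_apply, matchV, map_add, map_neg, map_smul]
  congr 1
  abel

/-- The gauge change of the rigging by z ∘ φ⁻¹ and φ_⋆ V, pulled back by φ; naturality turns £_{φ_⋆
V} γ̂ into £_V γ. -/
theorem Yplus_apply (hD : D.IsNull) (hDh : Dh.IsEmbedded Gp ιp Lp) (p : N)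
    (u v : TangentSpace (𝓡 (m + 1)) p) :
    Yplus D Dh φ Gp ιp Lp p u v =
      z p * Dh.Y (φ p) (mfderiv (𝓡 (m + 1)) (𝓡 (m + 1)) φ p u)
        (mfderiv (𝓡 (m + 1)) (𝓡 (m + 1)) φ p v) +
      (1 / 2 : ℝ) * (mvfderiv (𝓡 (m + 1)) z p u * (pullEll Dh φ p v + D.γ p (V p) v) +
        mvfderiv (𝓡 (m + 1)) z p v * (pullEll Dh φ p u + D.γ p (V p) u)) +
      (1 / 2 : ℝ) * (z p * lieTensor (𝓡 (m + 1)) V D.γ p u v) := by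
  have e := pullLie_gauge hDh (h.z_smooth.comp φ.symm.contMDiff) (push_smooth φ h.V_smooth) (φ p)
    (mfderiv (𝓡 (m + 1)) (𝓡 (m + 1)) φ p u) (mfderiv (𝓡 (m + 1)) (𝓡 (m + 1)) φ p v)
  have hpull : SmoothTensor (𝓡 (m + 1)) (pullTensor (𝓡 (m + 1)) (𝓡 (m + 1)) φ Dh.γ) :=
    h.γ_eq ▸ D.γ_smooth
  simp only [Function.comp_def] at e
  rw [lieTensor_push φ h.V_smooth Dh.γ_smooth hpull, h.γ_eq, mvfderiv_comp_symm φ h.z_smooth,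
    mvfderiv_comp_symm φ h.z_smooth, push_apply, h.γ_apply, h.γ_apply, φ.symm_apply_apply] at e
  have hY : Yplus D Dh φ Gp ιp Lp p u v = (1 / 2 : ℝ) *
      pullLie (𝓡 (m + 1)) (𝓡∂ (m + 2)) ιp (matchRigging D Dh φ ιp Lp) Gp.g (φ p)
        (mfderiv (𝓡 (m + 1)) (𝓡 (m + 1)) φ p u) (mfderiv (𝓡 (m + 1)) (𝓡 (m + 1)) φ p v) := rfl
  have hell : ∀ w, Dh.ell (φ p) (mfderiv (𝓡 (m + 1)) (𝓡 (m + 1)) φ p w) = pullEll Dh φ p w :=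
    fun w => rfl
  rw [hell, hell] at e
  rw [hY, h.matchRigging_eq hD, e]
  ring

/-- The jump of `Y` on arbitrary tangent vectors. -/
theorem jumpY_apply (hD : D.IsNull) (hDh : Dh.IsEmbedded Gp ιp Lp) {p : N}
    (hn : ContMDiffAt (𝓡 (m + 1)) (𝓡 (m + 1)).tangent ∞
      (fun p => (⟨p, D.n p⟩ : TangentBundle (𝓡 (m + 1)) N)) p)
    (u v : TangentSpace (𝓡 (m + 1)) p) :
    jumpY D Dh φ Gp ιp Lp p u v =
      z p * Dh.Y (φ p) (mfderiv (𝓡 (m + 1)) (𝓡 (m + 1)) φ p u)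
        (mfderiv (𝓡 (m + 1)) (𝓡 (m + 1)) φ p v) - D.Y p u v -
      z p * D.symNablaForm (pullEll Dh φ) p u v +
      z p ^ 2 / 2 * matchQ D Dh φ p * D.U p u v := by
  have e := hD.lieTensor_γ hn (h.z_smooth p)
    (differentiableAt_coordForm_pullForm φ.contMDiff Dh.ell_smooth p) h.V_smooth h.ell_apply u v
  have hzn := h.mul_pullEll_n hD p
  -- The coefficient of U: ℓ(P(η, ·)) = -ℓ⁽²⁾ η(n) = -ℓ⁽²⁾/z, so z ℓ(V) = ℓ⁽²⁾ + z μ and z μ is half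
  -- of z² (P(η, η) - φ^⋆ℓ̂⁽²⁾).
  have hV : z p * D.ell p (V p) - D.ell2 p = z p ^ 2 / 2 * matchQ D Dh φ p := by
    have hP := (D.relations p).2.2.1 (pullEll Dh φ p)
    have hz1 : pullEll Dh φ p (D.n p) = 1 / z p := eq_one_div_of_mul_eq_one_right hzn
    have hz := h.z_ne_zero p
    rw [h.eq_matchV hD, matchV, map_add, map_neg, map_smul, hD.ell_n, matchMu, smul_eq_mul, mul_one,
      hz1]
    rw [hz1] at hP
    field_simp at hP ⊢
    linear_combination (-2 : ℝ) * hP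
  have hj : jumpY D Dh φ Gp ιp Lp p u v = Yplus D Dh φ Gp ιp Lp p u v - D.Y p u v := rfl
  change z p * _ = _ - 2 * z p * D.symNablaForm (pullEll Dh φ) p u v + _ at e
  rw [hj, h.Yplus_apply hD hDh, e, hV]
  change _ + (1 / 2 : ℝ) * (-(_ * (pullEll Dh φ p v + _) + _ * (pullEll Dh φ p u + _)) - _ + _) - _ = _
  ring

end MatchingConditions

namespace MetricHypersurfaceData

theorem symNablaForm_symm (D : MetricHypersurfaceData m N) (η : OneForm (𝓡 (m + 1)) N) (p : N)
    (u v : TangentSpace (𝓡 (m + 1)) p) : D.symNablaForm η p u v = D.symNablaForm η p v u := by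
  rw [symNablaForm_eq, symNablaForm_eq]
  ring

theorem s_n (D : MetricHypersurfaceData m N) (p : N) : D.s p (D.n p) = 0 := by
  rw [MetricHypersurfaceData.s, F_apply]
  ring

namespace IsNull

variable {D : MetricHypersurfaceData m N} (hD : D.IsNull) {p : N}
  (hn : ContMDiffAt (𝓡 (m + 1)) (𝓡 (m + 1)).tangent ∞
    (fun p => (⟨p, D.n p⟩ : TangentBundle (𝓡 (m + 1)) N)) p)
include hD hn

theorem christoffel_symm (u v : TangentSpace (𝓡 (m + 1)) p) :
    D.christoffel p u v = D.christoffel p v u := by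
  refine D.eq_of_γ_ell_eq p ?_ ?_
  · ext w
    rw [hD.γ_christoffel hn, hD.γ_christoffel hn, D.U_symm p u v, firstKind_apply, firstKind_apply,
      dTensor_symm D.γ_symm p w u v]
    ring
  · rw [hD.ell_christoffel hn, hD.ell_christoffel hn, D.U_symm p u v]
    ring

section

omit hD in
/-- The derivative of `η(n) = 1 / z`, in components. -/
theorem sq_mul_dForm_n {z : N → ℝ} {η : OneForm (𝓡 (m + 1)) N}
    (hz : ContMDiff (𝓡 (m + 1)) 𝓘(ℝ, ℝ) ∞ z)
    (hη : DifferentiableAt ℝ (coordForm (𝓡 (m + 1)) p η) (extChartAt (𝓡 (m + 1)) p p))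
    (h : ∀ q, z q * η q (D.n q) = 1) (u : TangentSpace (𝓡 (m + 1)) p) :
    z p ^ 2 * (dForm _ η p u (D.n p) + η p (dField _ D.n p u)) +
      mvfderiv (𝓡 (m + 1)) z p u = 0 := by
  have hz0 : ∀ q, z q ≠ 0 := fun q h0 => by simpa [h0] using h q
  have hk : ContMDiff (𝓡 (m + 1)) 𝓘(ℝ, ℝ) ∞ (fun q => (z q)⁻¹) := fun q =>
    (hz q).inv₀ (hz0 q)
  have e1 := mvfderiv_apply_field (hk p) hη hn (fun q =>
    (eq_inv_of_mul_eq_one_right (h q)).symm) u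
  have hc : (fun q => z q * (z q)⁻¹) = fun _ => (1 : ℝ) := funext fun q => mul_inv_cancel₀ (hz0 q)
  have e2 := mvfderiv_fun_mul (hz.mdifferentiable (by simp) p) (hk.mdifferentiable (by simp) p)
  rw [hc] at e2
  have e3 := mvfderiv_const_eq_zero 1 p u
  rw [e2] at e3
  simp only [add_apply, smul_apply, smul_eq_mul, e1] at e3
  have := mul_inv_cancel₀ (hz0 p)
  linear_combination z p * e3 - mvfderiv (𝓡 (m + 1)) z p u * this

variable {z : N → ℝ} {η : OneForm (𝓡 (m + 1)) N}
  (hz : ContMDiff (𝓡 (m + 1)) 𝓘(ℝ, ℝ) ∞ z)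
  (hη : DifferentiableAt ℝ (coordForm (𝓡 (m + 1)) p η) (extChartAt (𝓡 (m + 1)) p p))
  (h : ∀ q, z q * η q (D.n q) = 1)
include hz hη h

/-- The contraction of `∇°_(a η_b)` with `n`, for a covector field with `η(n) = 1 / z`. -/
theorem symNablaForm_n (u : TangentSpace (𝓡 (m + 1)) p) :
    z p * D.symNablaForm η p (D.n p) u =
      z p / 2 * lieForm (𝓡 (m + 1)) D.n η p u - mvfderiv (𝓡 (m + 1)) z p u / (2 * z p) -
        D.s p u - z p * η p (D.P p (D.U p u)) := by
  have hz0 : z p ≠ 0 := fun h0 => by simpa [h0] using h p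
  have e2 := sq_mul_dForm_n hn hz hη h u
  -- The Lie derivative contains η(∂_u n), whereas ∇°η contains η(Γ(u, n)); η applied to ∇°_u n =
  -- s(u) n + P(U(u, ·), ·) trades one for the other, and `e2` supplies the derivative of 1/z.
  have e3 := congrArg (η p) (hD.christoffel_n hn u)
  rw [map_add, map_add, map_smul, smul_eq_mul] at e3
  rw [symNablaForm_eq, hD.christoffel_symm hn u, lieForm_eq_dForm]
  have hηn : η p (D.n p) = (z p)⁻¹ := eq_inv_of_mul_eq_one_right (h p)
  rw [hηn] at e3
  field_simp at e3 ⊢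
  linear_combination e2 - 2 * z p * e3

/-- The full contraction of `∇°_(a η_b)` with `n`, for a covector field with `η(n) = 1 / z`. -/
theorem symNablaForm_n_n :
    z p * D.symNablaForm η p (D.n p) (D.n p) = -(mvfderiv (𝓡 (m + 1)) z p (D.n p) / z p) := by
  have hz0 : z p ≠ 0 := fun h0 => by simpa [h0] using h p
  have e2 := sq_mul_dForm_n hn hz hη h (D.n p)
  have hUn : D.U p (D.n p) = 0 := ContinuousLinearMap.ext fun w => hD.U_n hn w
  rw [hD.symNablaForm_n hn hz hη h, lieForm_eq_dForm, s_n, hUn, map_zero, map_zero]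
  field_simp
  linear_combination e2

end

end IsNull

end MetricHypersurfaceData

end MatchedData

end

end NullShell

/-- Components of the jump `[Y]` and of the energy-momentum tensor of a general null shell. -/
theorem lemma4p9 {m : ℕ} {N : Type*} [TopologicalSpace N]
    [ChartedSpace (EuclideanSpace ℝ (Fin (m + 1))) N] [IsManifold (𝓡 (m + 1)) ∞ N]
    -- the two spacetimes with boundary
    {Mm : Type*} [TopologicalSpace Mm] [ChartedSpace (EuclideanHalfSpace (m + 2)) Mm]
    [IsManifold (𝓡∂ (m + 2)) ∞ Mm] (Gm : NullShell.LorentzMetric m Mm)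
    {Mp : Type*} [TopologicalSpace Mp] [ChartedSpace (EuclideanHalfSpace (m + 2)) Mp]
    [IsManifold (𝓡∂ (m + 2)) ∞ Mp] (Gp : NullShell.LorentzMetric m Mp)
    -- the embeddings onto the boundaries and the riggings
    (ιm : N → Mm) (Lm : NullShell.FieldAlong (𝓡∂ (m + 2)) ιm)
    (ιp : N → Mp) (Lp : NullShell.FieldAlong (𝓡∂ (m + 2)) ιp)
    (hιm : Set.range ιm = (𝓡∂ (m + 2)).boundary Mm)
    (hιp : Set.range ιp = (𝓡∂ (m + 2)).boundary Mp)
    (εm εp : ℝ) (hεm : NullShell.RiggingSign ιm Lm εm) (hεp : NullShell.RiggingSign ιp Lp εp)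
    -- the embedded null hypersurface data
    (D Dh : NullShell.HypersurfaceData m N)
    (hD : D.IsEmbedded Gm ιm Lm) (hDh : Dh.IsEmbedded Gp ιp Lp)
    (hDnull : D.IsNull) (hDhnull : Dh.IsNull)
    -- the matching conditions
    (φ : N ≃ₘ^∞⟮𝓡 (m + 1), 𝓡 (m + 1)⟯ N)
    (hmatch : ∃ (z : N → ℝ) (V : NullShell.VectorField (𝓡 (m + 1)) N),
      NullShell.MatchingConditions D Dh φ z V εp εm)
    -- a smooth basis `{n, e_A}` of vector fields on an open set `O`, and its dual basis
    (O : Set N) (hO : IsOpen O) (e : Fin m → NullShell.VectorField (𝓡 (m + 1)) N)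
    (he : IsLocalFrameOn (𝓡 (m + 1)) (EuclideanSpace ℝ (Fin (m + 1))) ∞
      (Fin.cons D.n e : Fin (m + 1) → NullShell.VectorField (𝓡 (m + 1)) N) O)
    (ν : NullShell.OneForm (𝓡 (m + 1)) N) (θ : Fin m → NullShell.OneForm (𝓡 (m + 1)) N)
    (hνn : ∀ p ∈ O, ν p (D.n p) = 1) (hνe : ∀ p ∈ O, ∀ A, ν p (e A p) = 0)
    (hθn : ∀ p ∈ O, ∀ A, θ A p (D.n p) = 0)
    (hθe : ∀ p ∈ O, ∀ A B, θ A p (e B p) = if A = B then 1 else 0) :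
    let z : N → ℝ := NullShell.matchZ D Dh φ
    let Q : N → ℝ := NullShell.matchQ D Dh φ
    let η : NullShell.OneForm (𝓡 (m + 1)) N := NullShell.pullEll Dh φ
    let jY : NullShell.TwoTensor (𝓡 (m + 1)) N := NullShell.jumpY D Dh φ Gp ιp Lp
    let W : Fin m → NullShell.VectorField (𝓡 (m + 1)) N := fun A => NullShell.vecW D Dh φ (e A)
    let χ : Fin m → N → ℝ := fun A => NullShell.chi D Dh φ (e A)
    let τ := D.energyMomentum εm jY
    let hinv := NullShell.invFrameMetric D e
    ∀ p ∈ O,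
      (jY p (D.n p) (D.n p) =
        1 / z p * Dh.Y (φ p) (Dh.n (φ p)) (Dh.n (φ p)) - D.Y p (D.n p) (D.n p) +
          mvfderiv (𝓡 (m + 1)) z p (D.n p) / z p) ∧
      (∀ A, jY p (D.n p) (e A p) =
        (Dh.Y (φ p) (Dh.n (φ p)) (W A (φ p)) +
            χ A (φ p) * Dh.Y (φ p) (Dh.n (φ p)) (Dh.n (φ p))) -
          D.Y p (D.n p) (e A p) -
          z p / 2 * NullShell.lieForm (𝓡 (m + 1)) D.n η p (e A p) +
          mvfderiv (𝓡 (m + 1)) z p (e A p) / (2 * z p) + D.s p (e A p) +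
          z p * η p (D.P p (D.U p (e A p)))) ∧
      (∀ A B, jY p (e A p) (e B p) =
        z p * (Dh.Y (φ p) (W A (φ p)) (W B (φ p)) +
            χ A (φ p) * Dh.Y (φ p) (Dh.n (φ p)) (W B (φ p)) +
            χ B (φ p) * Dh.Y (φ p) (Dh.n (φ p)) (W A (φ p)) +
            χ A (φ p) * χ B (φ p) * Dh.Y (φ p) (Dh.n (φ p)) (Dh.n (φ p))) -
          D.Y p (e A p) (e B p) - z p * D.symNablaForm η p (e A p) (e B p) +
          z p ^ 2 / 2 * Q p * D.U p (e A p) (e B p)) ∧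
      (τ p (ν p) (ν p) = -εm * ∑ A, ∑ B, hinv p A B * jY p (e A p) (e B p)) ∧
      (∀ A, τ p (ν p) (θ A p) = εm * ∑ B, hinv p A B * jY p (D.n p) (e B p)) ∧
      (∀ A B, τ p (θ A p) (θ B p) = -εm * hinv p A B * jY p (D.n p) (D.n p)) := by
  intro z Q η jY W χ τ hinv p hp
  obtain ⟨z₀, V, h⟩ := hmatch
  have hzz : z = z₀ := (h.eq_matchZ hDnull).symm
  -- Smoothness of n on O is read off from the frame, whose vector of index 0 is n.
  have hn : ContMDiffAt (𝓡 (m + 1)) (𝓡 (m + 1)).tangent ∞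
      (fun p => (⟨p, D.n p⟩ : TangentBundle (𝓡 (m + 1)) N)) p := he.contMDiffAt hO hp 0
  have hJ : ∀ u v, jY p u v = z p * Dh.Y (φ p) (mfderiv (𝓡 (m + 1)) (𝓡 (m + 1)) φ p u)
      (mfderiv (𝓡 (m + 1)) (𝓡 (m + 1)) φ p v) - D.Y p u v - z p * D.symNablaForm η p u v +
      z p ^ 2 / 2 * Q p * D.U p u v := fun u v => by
    rw [hzz]; exact h.jumpY_apply hDnull hDh hn u v
  have hzη : ∀ q, z q * η q (D.n q) = 1 := fun q => by
    rw [hzz]; exact h.mul_pullEll_n hDnull q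
  have hz0 : z p ≠ 0 := fun h0 => by simpa [h0] using hzη p
  have hηn : η p (D.n p) = (z p)⁻¹ := eq_inv_of_mul_eq_one_right (hzη p)
  have hzs : ContMDiff (𝓡 (m + 1)) 𝓘(ℝ, ℝ) ∞ z := hzz ▸ h.z_smooth
  have hφn : mfderiv (𝓡 (m + 1)) (𝓡 (m + 1)) φ p (D.n p) = (z p)⁻¹ • Dh.n (φ p) := by
    rw [← hηn]; exact h.mfderiv_n hDnull hDhnull p
  have hφe : ∀ A, mfderiv (𝓡 (m + 1)) (𝓡 (m + 1)) φ p (e A p) =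
      W A (φ p) + χ A (φ p) • Dh.n (φ p) := fun A => h.mfderiv_eq_vecW hDnull (e A) p
  have hη : DifferentiableAt ℝ (NullShell.coordForm (𝓡 (m + 1)) p η)
      (extChartAt (𝓡 (m + 1)) p p) :=
    NullShell.differentiableAt_coordForm_pullForm φ.contMDiff Dh.ell_smooth p
  have hsymm : ∀ u v, jY p u v = jY p v u := fun u v => by
    rw [hJ, hJ, Dh.Y_symm, D.Y_symm, D.symNablaForm_symm, D.U_symm]
  obtain ⟨t1, t2, t3⟩ := D.energyMomentum_frame hDnull εm jY p hsymm
    (b := he.toBasisAt hp) (e := fun A => e A p) (ν := ν p) (θ := fun A => θ A p)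
    (fun i => by
      rw [he.toBasisAt_coe hp]
      refine Fin.cases ?_ (fun A => ?_) i <;> simp)
    (hνn p hp) (hνe p hp) (hθn p hp) (hθe p hp)
  refine ⟨?_, fun A => ?_, fun A B => ?_, t1, t2, t3⟩
  -- φ_⋆ n = z⁻¹ n̂ in both slots turns the factor z into 1/z.
  · have e1 := hDnull.symNablaForm_n_n hn hzs hη hzη
    rw [hJ, hφn, hDnull.U_n hn, e1]
    simp only [map_smul, smul_apply, smul_eq_mul]
    field_simp
    ring
  · rw [hJ, hφn, hφe, hDnull.U_n hn, hDnull.symNablaForm_n hn hzs hη hzη]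
    simp only [map_add, map_smul, smul_apply, smul_eq_mul]
    -- A single factor z⁻¹ from φ_⋆ n cancels the prefactor z.
    linear_combination (Dh.Y (φ p) (Dh.n (φ p)) (W A (φ p)) +
      χ A (φ p) * Dh.Y (φ p) (Dh.n (φ p)) (Dh.n (φ p))) * mul_inv_cancel₀ hz0
  · rw [hJ, hφe, hφe]
    simp only [map_add, map_smul, add_apply, smul_apply, smul_eq_mul]
    rw [Dh.Y_symm (φ p) (W A (φ p)) (Dh.n (φ p))]
    ring
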